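/- Let $d\ge 1$, let $\Lambda\subset\mathbb R^d$ be a bounded set and let $\Omega\subset\Lambda$ be open. Let $H^1_0(\Lambda)$ denote the closure in $H^1(\mathbb R^d)$ of the set of $C_c^\infty(\mathbb{R}^d)$ functions with support contained in $\Lambda$ (for open $\Lambda$ this is the usual space, its elements being extended by zero to $\mathbb R^d$). For $s\in(0,\frac12)$ put $C_{d,s}=\frac{1-2s}{\alpha_d}$, where $\alpha_d$ is the volume of the unit ball of $\mathbb R^d$, let $$\widetilde G_s(\rho)=\int_0^1(1+\rho^2r^2)^{-\frac{d+1+2s}{2}}\,dr,\qquad Q_\Omega=(\mathbb R^d\times\mathbb R^d)\setminus(\Omega^c\times\Omega^c),\qquad \Omega^c=\mathbb R^d\setminus\Omega,$$ and define $$a_u(w,v)=C_{d,s}\iint_{Q_\Omega}\widetilde G_s\!\left(\frac{u(x)-u(y)}{|x-y|}\right)\frac{(w(x)-w(y))(v(x)-v(y))}{|x-y|^{d+1+2s}}\,dx\,dy .$$ Let $u,v\in H^1_0(\Lambda)$. Then the integral defining $a_u(u,v)$ converges absolutely for every $s\in(0,\frac12)$, the function $\frac{\nabla u\cdot\nabla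 v}{\sqrt{1+|\nabla u|^2}}$ is integrable on $\Omega$ (with $\nabla$ the weak gradient), and $$\lim_{s\to\frac12^-}a_u(u,v)=\int_\Omega\frac{\nabla u(x)\cdot\nabla v(x)}{\sqrt{1+|\nabla u(x)|^2}}\,dx .$$ -/

import Mathlib

open MeasureTheory Filter Topology
open scoped ContDiff

noncomputable section

/-- The function `g` is the weak gradient of `u` on the open set `U`. -/
def HasWeakGradient {d : ℕ} (U : Set (EuclideanSpace ℝ (Fin d)))
    (u : EuclideanSpace ℝ (Fin d) → ℝ)
    (g : EuclideanSpace ℝ (Fin d) → EuclideanSpace ℝ (Fin d)) : Prop :=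
  LocallyIntegrableOn u U volume ∧ LocallyIntegrableOn g U volume ∧
    ∀ φ : EuclideanSpace ℝ (Fin d) → ℝ,
      ContDiff ℝ ∞ φ → HasCompactSupport φ → tsupport φ ⊆ U →
        ∫ x in U, u x • gradient φ x = - ∫ x in U, φ x • g x

/-- Membership in `H^1_0(Λ)`, whose elements are regarded as functions on the whole space
(extended by zero outside `Λ`): `u` belongs to `H^1(ℝ^d)` and is the limit, in the norm of
`H^1(ℝ^d)`, of smooth functions with compact support contained in `Λ`. -/
def MemH10 {d : ℕ} (Λ : Set (EuclideanSpace ℝ (Fin d)))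
    (u : EuclideanSpace ℝ (Fin d) → ℝ) : Prop :=
  MemLp u 2 volume ∧
    ∃ g : EuclideanSpace ℝ (Fin d) → EuclideanSpace ℝ (Fin d),
      MemLp g 2 volume ∧ HasWeakGradient Set.univ u g ∧
      ∃ φ : ℕ → EuclideanSpace ℝ (Fin d) → ℝ,
        (∀ n, ContDiff ℝ ∞ (φ n) ∧ HasCompactSupport (φ n) ∧ tsupport (φ n) ⊆ Λ) ∧
        Tendsto (fun n => eLpNorm (fun x => φ n x - u x) 2 volume) atTop (𝓝 0) ∧
        Tendsto (fun n => eLpNorm (fun x => gradient (φ n) x - g x) 2 volume) atTop (𝓝 0)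

/-- The weight `G̃_s(ρ) = ∫_0^1 (1 + ρ² r²)^{-(d+1+2s)/2} dr`. -/
def GTilde (d : ℕ) (s ρ : ℝ) : ℝ :=
  ∫ r in (0 : ℝ)..1, (1 + ρ ^ 2 * r ^ 2) ^ (-(((d : ℝ) + 1 + 2 * s) / 2))

/-- The scaling constant `C_{d,s} = (1 - 2s) / α_d`, with `α_d` the volume of the unit ball
of `ℝ^d`. -/
def scalingConst (d : ℕ) (s : ℝ) : ℝ :=
  (1 - 2 * s) / volume.real (Metric.ball (0 : EuclideanSpace ℝ (Fin d)) 1)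

/-- The set `Q_Ω = (ℝ^d × ℝ^d) \ (Ω^c × Ω^c)`. -/
def interactionSet {d : ℕ} (Ω : Set (EuclideanSpace ℝ (Fin d))) :
    Set (EuclideanSpace ℝ (Fin d) × EuclideanSpace ℝ (Fin d)) :=
  (Ωᶜ ×ˢ Ωᶜ)ᶜ

/-- The integrand of the form `a_u(w,v)`, at the pair `p = (x, y)`. -/
def formIntegrand {d : ℕ} (s : ℝ) (u w v : EuclideanSpace ℝ (Fin d) → ℝ)
    (p : EuclideanSpace ℝ (Fin d) × EuclideanSpace ℝ (Fin d)) : ℝ :=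
  GTilde d s ((u p.1 - u p.2) / ‖p.1 - p.2‖) *
    ((w p.1 - w p.2) * (v p.1 - v p.2) / ‖p.1 - p.2‖ ^ ((d : ℝ) + 1 + 2 * s))

/-- The rescaled form `a_u(w,v)` of order `s`. -/
def rescaledForm {d : ℕ} (s : ℝ) (Ω : Set (EuclideanSpace ℝ (Fin d)))
    (u w v : EuclideanSpace ℝ (Fin d) → ℝ) : ℝ :=
  scalingConst d s * ∫ p in interactionSet Ω, formIntegrand s u w v p

end

/-! Put `x = h + y`. The integrand is symmetric in its two points, so `Q_Ω` may be traded for a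
weight that keeps one point in `Ω` and counts the pair twice when the other is outside. The form
then becomes the integral over increments `h` of `‖h‖ ^ (-(d - 1 + 2s)) * F_s(h)`, where `F_s(h)`
(`sliceForm`) is an integral over `x` involving only the difference quotients `D_h u`, `D_h v`. In
polar coordinates `h = rθ` the Jacobian leaves `(1 - 2s) r ^ (-2s) dr` on each ray. These measures
concentrate at `r = 0` as `s → 1/2` (`tendsto_mul_integral_rpow_mul`), so only `F_s(rθ)` for small
`r` matters.

Difference quotients of an `H^1` function converge in `L²` to directional derivatives, and `ρ ↦ ρ
G̃_s(ρ)` is 1-Lipschitz for every `s ≥ 0`. Hence `F_s(rθ)` tends, jointly in `s` and `r`, to the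
integral over `Ω` of `G̃_{1/2}(∇u·θ) (∇u·θ) (∇v·θ)` (`tendsto_sliceForm`). The bounds `|F_s(h)| ≤
min A (B / ‖h‖²)`, from the gradients and from the functions themselves, give absolute convergence
and domination.

It remains to average over the sphere. `integral_sphere_GTilde` gives `α_d (a·b) / √(1 + |a|²)` for
the integral of `G̃_{1/2}(a·θ) (a·θ) (b·θ)`, obtained by evaluating an anisotropic Gaussian moment
both in Cartesian and in polar coordinates. -/

/-! ### Polar coordinates -/

section Polar

variable {E : Type*} [NormedAddCommGroup E] [NormedSpace ℝ E] [FiniteDimensional ℝ E]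
  [MeasurableSpace E] [BorelSpace E]

/-- The origin is a null set, so nothing is lost in passing to the punctured space, which is the
product of the sphere and the half-line. -/
theorem measurePreserving_polarCoord [Nontrivial E] (μ : Measure E) [μ.IsAddHaarMeasure] :
    MeasurePreserving (fun p : Metric.sphere (0 : E) 1 × Set.Ioi (0 : ℝ) => (p.2 : ℝ) • (p.1 : E))
      (μ.toSphere.prod (Measure.volumeIoiPow (Module.finrank ℝ E - 1))) μ := by
  have h1 := (μ.measurePreserving_homeomorphUnitSphereProd).symm
    (homeomorphUnitSphereProd E).toMeasurableEquiv
  have h2 : MeasurePreserving (Subtype.val : ({0}ᶜ : Set E) → E) (μ.comap Subtype.val) μ := by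
    refine ⟨measurable_subtype_coe, ?_⟩
    rw [(MeasurableEmbedding.subtype_coe (measurableSet_singleton (0 : E)).compl).map_comap,
      Subtype.range_coe, restrict_compl_singleton]
  exact h2.comp h1

theorem measurableEmbedding_polarCoord :
    MeasurableEmbedding
      (fun p : Metric.sphere (0 : E) 1 × Set.Ioi (0 : ℝ) => (p.2 : ℝ) • (p.1 : E)) :=
  (MeasurableEmbedding.subtype_coe (measurableSet_singleton (0 : E)).compl).comp
    (homeomorphUnitSphereProd E).symm.measurableEmbedding

theorem integral_volumeIoiPow (n : ℕ) (g : ℝ → ℝ) :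
    ∫ r : Set.Ioi (0 : ℝ), g r ∂(Measure.volumeIoiPow n) =
      ∫ r in Set.Ioi (0 : ℝ), r ^ n * g r := by
  simp only [Measure.volumeIoiPow, ENNReal.ofReal]
  rw [integral_withDensity_eq_integral_smul,
    integral_subtype_comap measurableSet_Ioi fun a ↦ Real.toNNReal (a ^ n) • g a,
    setIntegral_congr_fun measurableSet_Ioi fun x hx ↦ ?_]
  · rw [NNReal.smul_def, Real.coe_toNNReal _ (pow_nonneg (Set.mem_Ioi.1 hx).le _), smul_eq_mul]
  · exact (measurable_subtype_coe.pow_const _).real_toNNReal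

variable [Nontrivial E] (μ : Measure E) [μ.IsAddHaarMeasure] {f : E → ℝ}

theorem integrable_polar (hf : Integrable f μ) :
    Integrable (fun θ : Metric.sphere (0 : E) 1 =>
      ∫ r in Set.Ioi (0 : ℝ), r ^ (Module.finrank ℝ E - 1) * f (r • (θ : E))) μ.toSphere := by
  have h := ((measurePreserving_polarCoord μ).integrable_comp_emb
    measurableEmbedding_polarCoord).2 hf
  refine h.integral_prod_left.congr (Eventually.of_forall fun θ => ?_)
  exact integral_volumeIoiPow _ fun r => f (r • (θ : E))

/-- Integration in polar coordinates. -/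
theorem integral_polar (hf : Integrable f μ) :
    ∫ x, f x ∂μ = ∫ θ : Metric.sphere (0 : E) 1,
      (∫ r in Set.Ioi (0 : ℝ), r ^ (Module.finrank ℝ E - 1) * f (r • (θ : E))) ∂μ.toSphere := by
  have h := ((measurePreserving_polarCoord μ).integrable_comp_emb
    measurableEmbedding_polarCoord).2 hf
  rw [← (measurePreserving_polarCoord μ).integral_comp measurableEmbedding_polarCoord]
  refine (integral_prod _ h).trans (integral_congr_ae (Eventually.of_forall fun θ => ?_))
  exact integral_volumeIoiPow _ fun r => f (r • (θ : E))

end Polar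

/-! ### Gaussian moments and the resulting integrals over the sphere -/

section Gaussian

theorem integral_sq_mul_exp_neg_mul_sq {c : ℝ} (hc : 0 < c) :
    ∫ x : ℝ, x ^ 2 * Real.exp (-c * x ^ 2) = √Real.pi / 2 * c ^ (-(3 : ℝ) / 2) := by
  have h1 := integral_rpow_mul_exp_neg_mul_rpow (p := 2) (q := 2) two_pos (by norm_num) hc
  have h2 : ∫ x : ℝ, x ^ 2 * Real.exp (-c * x ^ 2) =
      2 * ∫ x in Set.Ioi (0 : ℝ), x ^ 2 * Real.exp (-c * x ^ 2) := by
    have := integral_comp_abs (f := fun x : ℝ => x ^ 2 * Real.exp (-c * x ^ 2))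
    simpa using this
  have h3 : Real.Gamma (3 / 2) = √Real.pi / 2 := by
    have := Real.Gamma_add_one (s := 1 / 2) (by norm_num)
    rw [Real.Gamma_one_half_eq] at this
    rw [← show (1 / 2 + 1 : ℝ) = 3 / 2 by norm_num, this]; ring
  simp only [Real.rpow_two] at h1
  norm_num at h1
  rw [h2]
  norm_num
  rw [h1, h3]
  ring_nf

variable {E : Type*} [NormedAddCommGroup E] [InnerProductSpace ℝ E] [FiniteDimensional ℝ E]
  [MeasurableSpace E] [BorelSpace E]

theorem integrable_norm_sq_mul_exp_neg_norm_sq :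
    Integrable (fun x : E => ‖x‖ ^ 2 * Real.exp (-‖x‖ ^ 2)) := by
  nontriviality E
  rw [integrable_fun_norm_addHaar volume (f := fun r => r ^ 2 * Real.exp (-r ^ 2))]
  have h := integrableOn_rpow_mul_exp_neg_mul_sq (b := 1) one_pos
    (s := (Module.finrank ℝ E - 1 + 2 : ℕ)) (lt_of_lt_of_le (by norm_num) (Nat.cast_nonneg _))
  refine h.congr_fun (fun r _ => ?_) measurableSet_Ioi
  simp only [Real.rpow_natCast, smul_eq_mul, pow_add]
  ring_nf

theorem integrable_inner_mul_inner_mul_exp (e b : E) (t : ℝ) :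
    Integrable (fun x : E => inner ℝ e x * inner ℝ b x *
      Real.exp (-(‖x‖ ^ 2 + t ^ 2 * inner ℝ e x ^ 2))) := by
  refine ((integrable_norm_sq_mul_exp_neg_norm_sq (E := E)).const_mul (‖e‖ * ‖b‖)).mono'
    (by fun_prop) (Eventually.of_forall fun x => ?_)
  rw [norm_mul, norm_mul, Real.norm_of_nonneg (Real.exp_pos _).le]
  have h1 : Real.exp (-(‖x‖ ^ 2 + t ^ 2 * inner ℝ e x ^ 2)) ≤ Real.exp (-‖x‖ ^ 2) :=
    Real.exp_le_exp.2 (by nlinarith [mul_nonneg (sq_nonneg t) (sq_nonneg (inner ℝ e x))])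
  calc _ ≤ (‖e‖ * ‖x‖) * (‖b‖ * ‖x‖) * Real.exp (-‖x‖ ^ 2) := by
        gcongr
        · exact norm_inner_le_norm e x
        · exact norm_inner_le_norm b x
    _ = _ := by ring

/-- The reflection across the line through `e` preserves volume, norms and `inner ℝ e x`, but
changes the sign of `inner ℝ b x`; the integrand is odd under it. -/
theorem integral_inner_mul_inner_mul_exp_of_inner_eq_zero {e b : E} (he : ‖e‖ = 1)
    (h : inner ℝ e b = 0) (t : ℝ) :
    ∫ x : E, inner ℝ e x * inner ℝ b x *
      Real.exp (-(‖x‖ ^ 2 + t ^ 2 * inner ℝ e x ^ 2)) = 0 := by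
  let R := (ℝ ∙ e).reflection
  have hRe : ∀ x, inner ℝ e (R x) = inner ℝ e x := fun x => by
    simp only [R, Submodule.reflection_singleton_apply, inner_sub_right, two_smul, inner_add_right,
      inner_smul_right, real_inner_self_eq_norm_sq, he]
    simp
  have hRb : ∀ x, inner ℝ b (R x) = - inner ℝ b x := fun x => by
    have h' : inner ℝ b e = 0 := by rw [real_inner_comm]; exact h
    simp [R, Submodule.reflection_singleton_apply, inner_sub_right, two_smul, inner_add_right,
      inner_smul_right, h']
  have key := (R.measurePreserving).integral_comp R.toHomeomorph.measurableEmbedding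
    (fun x : E => inner ℝ e x * inner ℝ b x * Real.exp (-(‖x‖ ^ 2 + t ^ 2 * inner ℝ e x ^ 2)))
  simp only [hRe, hRb, LinearIsometryEquiv.norm_map, mul_neg, neg_mul, integral_neg] at key
  linarith

/-- In an orthonormal basis whose first vector is `e` the integrand is a product of one-variable
functions: a second moment with rate `1 + t ^ 2` in the first coordinate and standard Gaussians in
the others. -/
theorem integral_inner_sq_mul_exp {e : E} (he : ‖e‖ = 1) (t : ℝ) :
    ∫ x : E, inner ℝ e x * inner ℝ e x *
      Real.exp (-(‖x‖ ^ 2 + t ^ 2 * inner ℝ e x ^ 2)) =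
      √Real.pi ^ Module.finrank ℝ E / 2 * (1 + t ^ 2) ^ (-(3 : ℝ) / 2) := by
  have hn : 0 < Module.finrank ℝ E := Module.finrank_pos_iff_exists_ne_zero.2
    ⟨e, by rintro rfl; simp at he⟩
  obtain ⟨n, hn⟩ : ∃ n, Module.finrank ℝ E = n + 1 := ⟨_, (Nat.succ_pred_eq_of_pos hn).symm⟩
  obtain ⟨B, hB⟩ := Orthonormal.exists_orthonormalBasis_extension_of_card_eq (𝕜 := ℝ) (E := E)
    (ι := Fin (n + 1)) (by simpa using hn) (v := fun _ => e) (s := {0}) (by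
      rw [orthonormal_iff_ite]
      rintro ⟨i, hi⟩ ⟨j, hj⟩
      obtain rfl := Set.mem_singleton_iff.1 hi
      obtain rfl := Set.mem_singleton_iff.1 hj
      simp [he])
  have hB0 : B 0 = e := hB 0 rfl
  have hmp : MeasurePreserving (fun x : Fin (n + 1) → ℝ => B.repr.symm (WithLp.toLp 2 x)) :=
    B.measurePreserving_repr_symm.comp (PiLp.volume_preserving_toLp _)
  have hemb : MeasurableEmbedding
      (fun x : Fin (n + 1) → ℝ => B.repr.symm (WithLp.toLp 2 x)) :=
    B.repr.symm.toHomeomorph.measurableEmbedding.comp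
      (MeasurableEquiv.toLp 2 (Fin (n + 1) → ℝ)).measurableEmbedding
  rw [← hmp.integral_comp hemb]
  have he' : ∀ x : Fin (n + 1) → ℝ, inner ℝ e (B.repr.symm (WithLp.toLp 2 x)) = x 0 := fun x => by
    rw [← hB0, ← B.repr_apply_apply]; simp
  let f : Fin (n + 1) → ℝ → ℝ := Fin.cons (fun y => y ^ 2 * Real.exp (-(1 + t ^ 2) * y ^ 2))
    (fun _ y => Real.exp (-1 * y ^ 2))
  have hf : ∀ x : Fin (n + 1) → ℝ, inner ℝ e (B.repr.symm (WithLp.toLp 2 x)) *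
      inner ℝ e (B.repr.symm (WithLp.toLp 2 x)) * Real.exp (-(‖B.repr.symm (WithLp.toLp 2 x)‖ ^ 2 +
        t ^ 2 * inner ℝ e (B.repr.symm (WithLp.toLp 2 x)) ^ 2)) = ∏ i, f i (x i) := fun x => by
    rw [he', LinearIsometryEquiv.norm_map, EuclideanSpace.norm_sq_eq, Fin.sum_univ_succ,
      Fin.prod_univ_succ]
    simp only [f, Fin.cons_zero, Fin.cons_succ, Real.norm_eq_abs, sq_abs, ← Real.exp_sum]
    rw [mul_assoc, mul_assoc, ← Real.exp_add, ← mul_assoc, ← sq]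
    congr 2
    rw [← Finset.mul_sum]
    ring
  simp_rw [hf]
  rw [integral_fintype_prod_volume_eq_prod, Fin.prod_univ_succ]
  simp only [f, Fin.cons_zero, Fin.cons_succ, integral_gaussian, Finset.prod_const,
    Finset.card_univ, Fintype.card_fin, div_one]
  rw [integral_sq_mul_exp_neg_mul_sq (by positivity), hn]
  ring

theorem integral_inner_mul_inner_mul_exp {e : E} (he : ‖e‖ = 1) (b : E) (t : ℝ) :
    ∫ x : E, inner ℝ e x * inner ℝ b x *
      Real.exp (-(‖x‖ ^ 2 + t ^ 2 * inner ℝ e x ^ 2)) =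
      inner ℝ e b * (√Real.pi ^ Module.finrank ℝ E / 2 * (1 + t ^ 2) ^ (-(3 : ℝ) / 2)) := by
  have h0 : inner ℝ e (b - inner ℝ e b • e) = 0 := by
    simp [inner_sub_right, inner_smul_right, he]
  rw [← integral_inner_sq_mul_exp he t, ← integral_const_mul, ← sub_eq_zero,
    ← integral_sub (integrable_inner_mul_inner_mul_exp e b t)
      ((integrable_inner_mul_inner_mul_exp e e t).const_mul _),
    ← integral_inner_mul_inner_mul_exp_of_inner_eq_zero he h0 t]
  congr 1 with x
  simp only [inner_sub_left, inner_smul_left, RCLike.conj_to_real]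
  ring

/-- The Gaussian moment is rewritten in polar coordinates. The radial integral produces the power
`-(n + 2) / 2` of `1 + t ^ 2 * inner ℝ e θ ^ 2`, with `n` the dimension, and the factor `Γ(n / 2 +
1) / 2`; the same Gamma value is the denominator in the volume of the unit ball. -/
theorem integral_sphere_inner_mul_inner {e : E} (he : ‖e‖ = 1) (b : E) (t : ℝ) :
    ∫ θ : Metric.sphere (0 : E) 1, inner ℝ e (θ : E) * inner ℝ b (θ : E) *
      (1 + t ^ 2 * inner ℝ e (θ : E) ^ 2) ^ (-(((Module.finrank ℝ E : ℝ) + 2) / 2))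
        ∂(volume : Measure E).toSphere =
      inner ℝ e b * (volume.real (Metric.ball (0 : E) 1) * (1 + t ^ 2) ^ (-(3 : ℝ) / 2)) := by
  have : Nontrivial E := ⟨e, 0, by rintro rfl; simp at he⟩
  have hn : 0 < Module.finrank ℝ E := Module.finrank_pos
  have hΓ : 0 < Real.Gamma ((Module.finrank ℝ E : ℝ) / 2 + 1) := Real.Gamma_pos_of_pos (by positivity)
  have h1 := integral_inner_mul_inner_mul_exp he b t
  rw [integral_polar _ (integrable_inner_mul_inner_mul_exp e b t)] at h1
  have h2 : ∀ θ : Metric.sphere (0 : E) 1,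
      ∫ r in Set.Ioi (0 : ℝ), r ^ (Module.finrank ℝ E - 1) *
        (inner ℝ e (r • (θ : E)) * inner ℝ b (r • (θ : E)) *
          Real.exp (-(‖r • (θ : E)‖ ^ 2 + t ^ 2 * inner ℝ e (r • (θ : E)) ^ 2))) =
      (inner ℝ e (θ : E) * inner ℝ b (θ : E) *
      (1 + t ^ 2 * inner ℝ e (θ : E) ^ 2) ^ (-(((Module.finrank ℝ E : ℝ) + 2) / 2))) *
        (Real.Gamma ((Module.finrank ℝ E : ℝ) / 2 + 1) / 2) := fun θ => by
    have hq : 0 < 1 + t ^ 2 * inner ℝ e (θ : E) ^ 2 := by positivity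
    -- The exponent `n + 1` is `n - 1` from the polar Jacobian plus `2` from the two inner products.
    have h3 := integral_rpow_mul_exp_neg_mul_rpow (p := 2) (q := (Module.finrank ℝ E + 1 : ℕ))
      two_pos (lt_of_lt_of_le (by norm_num) (Nat.cast_nonneg _)) hq
    have h4 : ∀ r ∈ Set.Ioi (0 : ℝ), r ^ (Module.finrank ℝ E - 1) *
        (inner ℝ e (r • (θ : E)) * inner ℝ b (r • (θ : E)) *
          Real.exp (-(‖r • (θ : E)‖ ^ 2 + t ^ 2 * inner ℝ e (r • (θ : E)) ^ 2))) =
        (inner ℝ e (θ : E) * inner ℝ b (θ : E)) * (r ^ ((Module.finrank ℝ E + 1 : ℕ) : ℝ) *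
          Real.exp (-(1 + t ^ 2 * inner ℝ e (θ : E) ^ 2) * r ^ (2 : ℝ))) := fun r hr => by
      have hθ : ‖(θ : E)‖ = 1 := norm_eq_of_mem_sphere θ
      rw [Real.rpow_natCast, Real.rpow_two, inner_smul_right, inner_smul_right, norm_smul, hθ,
        mul_one, Real.norm_eq_abs, sq_abs, show Module.finrank ℝ E + 1 =
          (Module.finrank ℝ E - 1) + 2 by omega, pow_add]
      ring_nf
    rw [setIntegral_congr_fun measurableSet_Ioi h4, integral_const_mul, h3]
    push_cast
    rw [show ((Module.finrank ℝ E : ℝ) + 1 + 1) / 2 = (Module.finrank ℝ E : ℝ) / 2 + 1 by ring,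
      show -((Module.finrank ℝ E : ℝ) + 1 + 1) / 2 = -(((Module.finrank ℝ E : ℝ) + 2) / 2) by ring]
    ring
  simp_rw [h2] at h1
  rw [integral_mul_const, ← eq_div_iff (by positivity)] at h1
  rw [h1, Measure.real, InnerProductSpace.volume_ball, ENNReal.ofReal_one, one_pow, one_mul,
    ENNReal.toReal_ofReal (by positivity)]
  field_simp

end Gaussian

/-! ### The weight `GTilde` and its average over directions -/

section Weight

theorem continuous_GTilde (d : ℕ) : Continuous fun q : ℝ × ℝ => GTilde d q.1 q.2 := by
  unfold GTilde
  refine intervalIntegral.continuous_parametric_intervalIntegral_of_continuous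
    (f := fun (q : ℝ × ℝ) r => (1 + q.2 ^ 2 * r ^ 2) ^ (-(((d : ℝ) + 1 + 2 * q.1) / 2))) ?_
    continuous_const
  refine Continuous.rpow (by fun_prop) (by fun_prop) fun x => Or.inl ?_
  positivity

@[fun_prop]
theorem continuous_GTilde_right (d : ℕ) (s : ℝ) : Continuous (GTilde d s) :=
  (continuous_GTilde d).comp (Continuous.prodMk_right s)

theorem abs_GTilde_le_one (d : ℕ) {s : ℝ} (hs : 0 ≤ s) (ρ : ℝ) : |GTilde d s ρ| ≤ 1 := by
  have := intervalIntegral.norm_integral_le_of_norm_le_const (a := 0) (b := 1) (C := 1)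
    (f := fun r : ℝ => (1 + ρ ^ 2 * r ^ 2) ^ (-(((d : ℝ) + 1 + 2 * s) / 2))) fun r _ => by
      rw [Real.norm_of_nonneg (by positivity)]
      exact Real.rpow_le_one_of_one_le_of_nonpos (le_add_of_nonneg_right (by positivity))
        (neg_nonpos.2 (by positivity))
  simpa [GTilde] using this

/-- Substituting `t = ρ r` exhibits `ρ * GTilde d s ρ` as a primitive of a function with values in
`(0, 1]` when `s ≥ 0`, which is the source of the Lipschitz bound below. -/
theorem GTilde_mul_self (d : ℕ) (s ρ : ℝ) :
    GTilde d s ρ * ρ = ∫ t in (0 : ℝ)..ρ, (1 + t ^ 2) ^ (-(((d : ℝ) + 1 + 2 * s) / 2)) := by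
  have := intervalIntegral.mul_integral_comp_mul_right (a := 0) (b := 1)
    (f := fun t : ℝ => (1 + t ^ 2) ^ (-(((d : ℝ) + 1 + 2 * s) / 2))) ρ
  rw [zero_mul, one_mul] at this
  rw [← this, mul_comm, GTilde]
  congr 2 with r
  ring_nf

theorem abs_GTilde_mul_self_sub_le (d : ℕ) {s : ℝ} (hs : 0 ≤ s) (a b : ℝ) :
    |GTilde d s a * a - GTilde d s b * b| ≤ |a - b| := by
  have hc : Continuous fun t : ℝ => (1 + t ^ 2) ^ (-(((d : ℝ) + 1 + 2 * s) / 2)) :=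
    Continuous.rpow_const (by fun_prop) fun t => Or.inl (by positivity)
  rw [GTilde_mul_self, GTilde_mul_self, intervalIntegral.integral_interval_sub_left
    (hc.intervalIntegrable _ _) (hc.intervalIntegrable _ _)]
  have := intervalIntegral.norm_integral_le_of_norm_le_const (a := b) (b := a) (C := 1)
    (f := fun t : ℝ => (1 + t ^ 2) ^ (-(((d : ℝ) + 1 + 2 * s) / 2))) fun t _ => by
      rw [Real.norm_of_nonneg (by positivity)]
      exact Real.rpow_le_one_of_one_le_of_nonpos (le_add_of_nonneg_right (by positivity))
        (neg_nonpos.2 (by positivity))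
  simpa using this

/-- An explicit primitive is `r * (1 + (ρ r)²) ^ (-1/2)`. -/
theorem integral_one_add_sq_mul_sq_rpow (ρ : ℝ) :
    ∫ r in (0 : ℝ)..1, (1 + (ρ * r) ^ 2) ^ (-(3 : ℝ) / 2) = (√(1 + ρ ^ 2))⁻¹ := by
  have hderiv : ∀ r : ℝ, HasDerivAt (fun r : ℝ => r * (1 + (ρ * r) ^ 2) ^ (-(1 : ℝ) / 2))
      ((1 + (ρ * r) ^ 2) ^ (-(3 : ℝ) / 2)) r := fun r => by
    have hpos : 0 < 1 + (ρ * r) ^ 2 := by positivity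
    have h1 : HasDerivAt (fun r : ℝ => 1 + (ρ * r) ^ 2) (2 * ρ ^ 2 * r) r := by
      have := (((hasDerivAt_id r).const_mul ρ).pow 2).const_add 1
      exact this.congr_deriv (by simp; ring)
    have h2 := (hasDerivAt_id r).mul (h1.rpow_const (p := -(1 : ℝ) / 2) (Or.inl hpos.ne'))
    refine h2.congr_deriv ?_
    have h3 : (1 + (ρ * r) ^ 2) ^ (-(1 : ℝ) / 2) =
        (1 + (ρ * r) ^ 2) ^ (-(3 : ℝ) / 2) * (1 + (ρ * r) ^ 2) := by
      rw [← Real.rpow_add_one hpos.ne']; norm_num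
    have h4 : (-(1 : ℝ) / 2 - 1) = -(3 : ℝ) / 2 := by norm_num
    rw [h3, h4]
    simp only [id]
    ring
  rw [intervalIntegral.integral_eq_sub_of_hasDerivAt (fun r _ => hderiv r)]
  · rw [Real.sqrt_eq_rpow, ← Real.rpow_neg (by positivity)]
    norm_num
  · refine Continuous.intervalIntegrable (Continuous.rpow_const (by fun_prop) fun r =>
      Or.inl ?_) _ _
    positivity

variable {E : Type*} [NormedAddCommGroup E] [InnerProductSpace ℝ E] [FiniteDimensional ℝ E]
  [MeasurableSpace E] [BorelSpace E]

/-- At `s = 1/2` the exponent in `GTilde` is exactly the one in `integral_sphere_inner_mul_inner`.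
Writing `a = ρ e` and exchanging the integrals, that lemma applies for each `r` with `t = ρ r`, and
the remaining integral over `r` is elementary. -/
theorem integral_sphere_GTilde (a b : E) :
    ∫ θ : Metric.sphere (0 : E) 1, GTilde (Module.finrank ℝ E) (1 / 2) (inner ℝ a (θ : E)) *
      inner ℝ a (θ : E) * inner ℝ b (θ : E) ∂(volume : Measure E).toSphere =
      volume.real (Metric.ball (0 : E) 1) * (inner ℝ a b / √(1 + ‖a‖ ^ 2)) := by
  rcases eq_or_ne a 0 with rfl | ha
  · simp
  obtain ⟨ρ, hρ, e, he, rfl⟩ : ∃ ρ : ℝ, 0 < ρ ∧ ∃ e : E, ‖e‖ = 1 ∧ a = ρ • e :=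
    ⟨‖a‖, norm_pos_iff.2 ha, ‖a‖⁻¹ • a, norm_smul_inv_norm ha, by
      rw [smul_inv_smul₀ (norm_ne_zero_iff.2 ha)]⟩
  have hG : ∀ θ : Metric.sphere (0 : E) 1,
      GTilde (Module.finrank ℝ E) (1 / 2) (inner ℝ (ρ • e) (θ : E)) *
      inner ℝ (ρ • e) (θ : E) * inner ℝ b (θ : E) = ∫ r in (0 : ℝ)..1,
        ρ * (inner ℝ e (θ : E) * inner ℝ b (θ : E) *
      (1 + (ρ * r) ^ 2 * inner ℝ e (θ : E) ^ 2) ^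
        (-(((Module.finrank ℝ E : ℝ) + 2) / 2))) := fun θ => by
    rw [intervalIntegral.integral_const_mul, intervalIntegral.integral_const_mul, GTilde,
      inner_smul_left, RCLike.conj_to_real]
    have : ∀ r : ℝ, (1 + (ρ * inner ℝ e (θ : E)) ^ 2 * r ^ 2) ^
        (-(((Module.finrank ℝ E : ℝ) + 1 + 2 * (1 / 2)) / 2)) =
        (1 + (ρ * r) ^ 2 * inner ℝ e (θ : E) ^ 2) ^
        (-(((Module.finrank ℝ E : ℝ) + 2) / 2)) := fun r => by
      congr 1 <;> ring
    simp_rw [this]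
    ring
  simp_rw [hG]
  rw [← intervalIntegral_integral_swap]
  · simp_rw [integral_const_mul, integral_sphere_inner_mul_inner he]
    simp_rw [intervalIntegral.integral_const_mul, integral_one_add_sq_mul_sq_rpow]
    rw [inner_smul_left, norm_smul, he, mul_one, Real.norm_eq_abs, sq_abs, RCLike.conj_to_real]
    ring
  · have hcont : Continuous (fun q : ℝ × Metric.sphere (0 : E) 1 =>
        ρ * (inner ℝ e (q.2 : E) * inner ℝ b (q.2 : E) *
      (1 + (ρ * q.1) ^ 2 * inner ℝ e (q.2 : E) ^ 2) ^
        (-(((Module.finrank ℝ E : ℝ) + 2) / 2)))) := by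
      refine continuous_const.mul (Continuous.mul (by fun_prop)
        (Continuous.rpow_const (by fun_prop) fun q => Or.inl ?_))
      positivity
    rw [Set.uIoc_of_le zero_le_one]
    refine Integrable.of_bound hcont.aestronglyMeasurable (ρ * (1 * ‖b‖ * 1))
      (Eventually.of_forall fun q => ?_)
    have hq : ‖(q.2 : E)‖ = 1 := norm_eq_of_mem_sphere q.2
    simp only [Function.uncurry_def]
    rw [norm_mul, norm_mul, norm_mul, Real.norm_of_nonneg hρ.le]
    gcongr
    · exact (norm_inner_le_norm _ _).trans (by rw [he, hq, mul_one])
    · exact (norm_inner_le_norm _ _).trans (by rw [hq, mul_one])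
    · rw [Real.norm_of_nonneg (by positivity)]
      exact Real.rpow_le_one_of_one_le_of_nonpos (le_add_of_nonneg_right (by positivity))
        (neg_nonpos.2 (by positivity))

end Weight

/-! ### Difference quotients of Sobolev functions -/

section DiffQuot

variable {E : Type*} [NormedAddCommGroup E]

/-- The difference quotient of `u` with increment `h`. -/
noncomputable def diffQuot (u : E → ℝ) (h x : E) : ℝ := (u (h + x) - u x) / ‖h‖

theorem diffQuot_sub (u w : E → ℝ) (h x : E) :
    diffQuot (fun y => u y - w y) h x = diffQuot u h x - diffQuot w h x := by
  simp only [diffQuot]; ring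

variable [InnerProductSpace ℝ E] [FiniteDimensional ℝ E]

theorem continuous_gradient {φ : E → ℝ} (hφ : ContDiff ℝ ∞ φ) : Continuous (gradient φ) :=
  (InnerProductSpace.toDual ℝ E).symm.continuous.comp (hφ.continuous_fderiv (by simp))

theorem HasCompactSupport.gradient {φ : E → ℝ} (hφ : HasCompactSupport φ) :
    HasCompactSupport (gradient φ) :=
  (hφ.fderiv ℝ).comp_left (g := (InnerProductSpace.toDual ℝ E).symm) (map_zero _)

theorem gradient_fun_sub {φ ψ : E → ℝ} (hφ : ContDiff ℝ ∞ φ) (hψ : ContDiff ℝ ∞ ψ) (x : E) :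
    gradient (fun y => φ y - ψ y) x = gradient φ x - gradient ψ x := by
  rw [gradient, gradient, gradient, fderiv_fun_sub (hφ.differentiable (by simp) x)
    (hψ.differentiable (by simp) x), map_sub]

/-- Fundamental theorem of calculus along the segment from `x` to `h + x`, then comparison of the
`L¹` and `L²` norms on the probability space `(0, 1]`. -/
theorem enorm_sub_sq_le_lintegral {φ : E → ℝ} (hφ : ContDiff ℝ ∞ φ) (h x : E) :
    ‖φ (h + x) - φ x‖ₑ ^ 2 ≤
      ‖h‖ₑ ^ 2 * ∫⁻ t in Set.Ioc (0 : ℝ) 1, ‖gradient φ (t • h + x)‖ₑ ^ 2 := by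
  have hg := continuous_gradient hφ
  have hc : Continuous fun t : ℝ => gradient φ (t • h + x) := by fun_prop
  have hderiv : ∀ t : ℝ, HasDerivAt (fun t : ℝ => φ (t • h + x))
      (inner ℝ (gradient φ (t • h + x)) h) t := fun t => by
    rw [inner_gradient_left]
    have h1 : HasDerivAt (fun t : ℝ => t • h + x) h t := by
      simpa using ((hasDerivAt_id t).smul_const h).add_const x
    exact ((hφ.differentiable (by simp)) _).hasFDerivAt.comp_hasDerivAt t h1
  have h1 : φ (h + x) - φ x = ∫ t in (0 : ℝ)..1, inner ℝ (gradient φ (t • h + x)) h := by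
    rw [intervalIntegral.integral_eq_sub_of_hasDerivAt (fun t _ => hderiv t)
      ((hc.inner continuous_const).intervalIntegrable _ _)]
    simp
  have h2 : ‖φ (h + x) - φ x‖ₑ ≤ ‖h‖ₑ * ∫⁻ t in Set.Ioc (0 : ℝ) 1, ‖gradient φ (t • h + x)‖ₑ := by
    rw [h1, intervalIntegral.integral_of_le zero_le_one,
      ← lintegral_const_mul _ hc.enorm.measurable]
    refine (enorm_integral_le_lintegral_enorm _).trans (lintegral_mono fun t => ?_)
    rw [mul_comm, ← ofReal_norm, ← ofReal_norm, ← ofReal_norm,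
      ← ENNReal.ofReal_mul (norm_nonneg _)]
    exact ENNReal.ofReal_le_ofReal (norm_inner_le_norm _ _)
  have : IsProbabilityMeasure (volume.restrict (Set.Ioc (0 : ℝ) 1)) := ⟨by simp⟩
  have h3 := eLpNorm_le_eLpNorm_of_exponent_le (p := 1) (q := 2)
    (μ := volume.restrict (Set.Ioc (0 : ℝ) 1)) (by norm_num) hc.aestronglyMeasurable
  rw [eLpNorm_one_eq_lintegral_enorm] at h3
  have h4 := eLpNorm_nnreal_pow_eq_lintegral (p := 2) (μ := volume.restrict (Set.Ioc (0 : ℝ) 1))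
    (f := fun t : ℝ => gradient φ (t • h + x)) two_ne_zero
  simp only [NNReal.coe_ofNat, ENNReal.rpow_ofNat, ENNReal.coe_ofNat] at h4
  rw [← h4, ← mul_pow]
  gcongr
  exact h2.trans (by gcongr)

variable [MeasurableSpace E] [BorelSpace E]

/-- `u` is the limit in `L²` of smooth compactly supported functions whose gradients converge
to `g` in `L²`. -/
def IsSobolevLimit (u : E → ℝ) (g : E → E) : Prop :=
  MemLp u 2 volume ∧ MemLp g 2 volume ∧ ∃ φ : ℕ → E → ℝ,
    (∀ n, ContDiff ℝ ∞ (φ n) ∧ HasCompactSupport (φ n)) ∧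
    Tendsto (fun n => eLpNorm (fun x => φ n x - u x) 2 volume) atTop (𝓝 0) ∧
    Tendsto (fun n => eLpNorm (fun x => gradient (φ n) x - g x) 2 volume) atTop (𝓝 0)

theorem memLp_gradient {φ : E → ℝ} (hφ : ContDiff ℝ ∞ φ) (hφc : HasCompactSupport φ) :
    MemLp (gradient φ) 2 volume :=
  (continuous_gradient hφ).memLp_of_hasCompactSupport hφc.gradient

theorem IsSobolevLimit.sub_smooth {u : E → ℝ} {g : E → E} (hu : IsSobolevLimit u g) {ψ : E → ℝ}
    (hψ : ContDiff ℝ ∞ ψ) (hψc : HasCompactSupport ψ) :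
    IsSobolevLimit (fun x => u x - ψ x) (fun x => g x - gradient ψ x) := by
  obtain ⟨hu2, hg2, φ, hφ, h1, h2⟩ := hu
  refine ⟨hu2.sub (hψ.continuous.memLp_of_hasCompactSupport hψc), hg2.sub (memLp_gradient hψ hψc),
    fun n x => φ n x - ψ x, fun n => ⟨(hφ n).1.sub hψ, (hφ n).2.sub hψc⟩, ?_, ?_⟩
  · simpa only [sub_sub_sub_cancel_right] using h1
  · simpa only [gradient_fun_sub (hφ _).1 hψ, sub_sub_sub_cancel_right] using h2

theorem IsSobolevLimit.congr {u u' : E → ℝ} {g g' : E → E} (hu : IsSobolevLimit u g)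
    (huu' : u =ᵐ[volume] u') (hgg' : g =ᵐ[volume] g') : IsSobolevLimit u' g' := by
  obtain ⟨hu2, hg2, φ, hφ, h1, h2⟩ := hu
  refine ⟨hu2.ae_eq huu', hg2.ae_eq hgg', φ, hφ, ?_, ?_⟩
  · exact h1.congr fun n => eLpNorm_congr_ae (by filter_upwards [huu'] with x hx; rw [hx])
  · exact h2.congr fun n => eLpNorm_congr_ae (by filter_upwards [hgg'] with x hx; rw [hx])

theorem eLpNorm_comp_add_left {F : Type*} [NormedAddCommGroup F] {f : E → F}
    (hf : AEStronglyMeasurable f) (h : E) :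
    eLpNorm (fun x => f (h + x)) 2 volume = eLpNorm f 2 volume :=
  eLpNorm_comp_measurePreserving hf (measurePreserving_add_left volume h)

/-- The pointwise bound is integrated in `x`; after Tonelli, translation invariance makes the inner
integral independent of `t`. -/
theorem eLpNorm_translate_sub_le_of_smooth {φ : E → ℝ} (hφ : ContDiff ℝ ∞ φ) (h : E) :
    eLpNorm (fun x => φ (h + x) - φ x) 2 volume ≤ ‖h‖ₑ * eLpNorm (gradient φ) 2 volume := by
  have hg := continuous_gradient hφ
  have key : eLpNorm (fun x => φ (h + x) - φ x) 2 volume ^ 2 ≤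
      (‖h‖ₑ * eLpNorm (gradient φ) 2 volume) ^ 2 := by
    have h4 := eLpNorm_nnreal_pow_eq_lintegral (p := 2) (μ := (volume : Measure E))
      (f := fun x => φ (h + x) - φ x) two_ne_zero
    have h5 := eLpNorm_nnreal_pow_eq_lintegral (p := 2) (μ := (volume : Measure E))
      (f := gradient φ) two_ne_zero
    simp only [NNReal.coe_ofNat, ENNReal.rpow_ofNat, ENNReal.coe_ofNat] at h4 h5
    rw [mul_pow, h4, h5]
    calc ∫⁻ x, ‖φ (h + x) - φ x‖ₑ ^ 2
        ≤ ∫⁻ x, ‖h‖ₑ ^ 2 * ∫⁻ t in Set.Ioc (0 : ℝ) 1, ‖gradient φ (t • h + x)‖ₑ ^ 2 :=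
          lintegral_mono fun x => enorm_sub_sq_le_lintegral hφ h x
      _ = ‖h‖ₑ ^ 2 * ∫⁻ x, ∫⁻ t in Set.Ioc (0 : ℝ) 1, ‖gradient φ (t • h + x)‖ₑ ^ 2 :=
          lintegral_const_mul' _ _ (by finiteness)
      _ = ‖h‖ₑ ^ 2 * ∫⁻ t in Set.Ioc (0 : ℝ) 1, ∫⁻ x, ‖gradient φ (t • h + x)‖ₑ ^ 2 := by
          rw [lintegral_lintegral_swap]
          have : Continuous fun p : E × ℝ => gradient φ (p.2 • h + p.1) := by fun_prop
          exact (this.measurable.enorm.pow_const 2).aemeasurable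
      _ = ‖h‖ₑ ^ 2 * ∫⁻ x, ‖gradient φ x‖ₑ ^ 2 := by
          simp [lintegral_add_left_eq_self fun x => ‖gradient φ x‖ₑ ^ 2]
  exact (ENNReal.pow_le_pow_left_iff two_ne_zero).1 key

theorem IsSobolevLimit.eLpNorm_translate_sub_le {u : E → ℝ} {g : E → E}
    (hu : IsSobolevLimit u g) (h : E) :
    eLpNorm (fun x => u (h + x) - u x) 2 volume ≤ ‖h‖ₑ * eLpNorm g 2 volume := by
  obtain ⟨hu2, hg2, φ, hφ, h1, h2⟩ := hu
  -- The factor `2` accounts for the error `φ n - u` at `x` and at `h + x`.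
  have hlim : Tendsto (fun n => 2 * eLpNorm (fun x => φ n x - u x) 2 volume +
      ‖h‖ₑ * (eLpNorm (fun x => gradient (φ n) x - g x) 2 volume + eLpNorm g 2 volume)) atTop
      (𝓝 (2 * 0 + ‖h‖ₑ * (0 + eLpNorm g 2 volume))) :=
    (ENNReal.Tendsto.const_mul h1 (by simp)).add
      (ENNReal.Tendsto.const_mul (h2.add tendsto_const_nhds) (by simp))
  simp only [mul_zero, zero_add] at hlim
  refine ge_of_tendsto' hlim fun n => ?_
  have hm : AEStronglyMeasurable (fun x => φ n x - u x) volume :=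
    (hφ n).1.continuous.aestronglyMeasurable.sub hu2.1
  have hm' : AEStronglyMeasurable (fun x => φ n (h + x) - u (h + x)) volume :=
    hm.comp_measurePreserving (measurePreserving_add_left volume h)
  have hc := (hφ n).1.continuous
  have hgm : AEStronglyMeasurable (fun x => gradient (φ n) x - g x) volume :=
    (continuous_gradient (hφ n).1).aestronglyMeasurable.sub hg2.1
  have e1 : (fun x => u (h + x) - u x) = (fun x => φ n (h + x) - φ n x) +
      ((fun x => φ n x - u x) - (fun x => φ n (h + x) - u (h + x))) := by
    ext x; simp only [Pi.add_apply, Pi.sub_apply]; ring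
  have e2 : gradient (φ n) = (fun x => gradient (φ n) x - g x) + g := by
    ext1 x; simp
  calc eLpNorm (fun x => u (h + x) - u x) 2 volume
      ≤ eLpNorm (fun x => φ n (h + x) - φ n x) 2 volume +
        (eLpNorm (fun x => φ n x - u x) 2 volume +
          eLpNorm (fun x => φ n (h + x) - u (h + x)) 2 volume) := by
        rw [e1]
        refine (eLpNorm_add_le (Continuous.aestronglyMeasurable (by fun_prop)) (hm.sub hm')
          (by norm_num)).trans ?_
        gcongr
        exact eLpNorm_sub_le hm hm' (by norm_num)
    _ ≤ ‖h‖ₑ * eLpNorm (gradient (φ n)) 2 volume +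
        (eLpNorm (fun x => φ n x - u x) 2 volume + eLpNorm (fun x => φ n x - u x) 2 volume) := by
        gcongr
        · exact eLpNorm_translate_sub_le_of_smooth (hφ n).1 h
        · exact (eLpNorm_comp_add_left hm h).le
    _ ≤ _ := by
        rw [← two_mul, add_comm]
        gcongr
        conv_lhs => rw [e2]
        exact eLpNorm_add_le hgm hg2.1 (by norm_num)

theorem eLpNorm_diffQuot (u : E → ℝ) (h : E) :
    eLpNorm (diffQuot u h) 2 volume =
      ‖h‖ₑ⁻¹ * eLpNorm (fun x => u (h + x) - u x) 2 volume := by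
  have : diffQuot u h = (‖h‖⁻¹ : ℝ) • fun x => u (h + x) - u x := by
    ext x; simp [diffQuot, div_eq_inv_mul]
  rw [this, eLpNorm_const_smul]
  -- For `h = 0` both sides vanish, the right one as `⊤ * 0`.
  rcases eq_or_ne h 0 with rfl | hh
  · simp
  · rw [enorm_inv (norm_ne_zero_iff.2 hh), enorm_norm]

theorem IsSobolevLimit.eLpNorm_diffQuot_le {u : E → ℝ} {g : E → E}
    (hu : IsSobolevLimit u g) (h : E) :
    eLpNorm (diffQuot u h) 2 volume ≤ eLpNorm g 2 volume := by
  rw [eLpNorm_diffQuot]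
  rcases eq_or_ne h 0 with rfl | hh
  · simp
  · calc _ ≤ ‖h‖ₑ⁻¹ * (‖h‖ₑ * eLpNorm g 2 volume) := by
          gcongr; exact hu.eLpNorm_translate_sub_le h
      _ = _ := by
          rw [← mul_assoc, ENNReal.inv_mul_cancel (by simpa using hh) (by simp), one_mul]

/-- This bound serves large increments, where it supplies the decay that the gradient bound lacks.
-/
theorem eLpNorm_diffQuot_le_of_memLp {u : E → ℝ} (hu : MemLp u 2 volume) (h : E) :
    eLpNorm (diffQuot u h) 2 volume ≤ ‖h‖ₑ⁻¹ * (2 * eLpNorm u 2 volume) := by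
  rw [eLpNorm_diffQuot, two_mul]
  gcongr
  refine (eLpNorm_sub_le (hu.1.comp_measurePreserving (measurePreserving_add_left volume h)) hu.1
    (by norm_num)).trans ?_
  gcongr
  exact (eLpNorm_comp_add_left hu.1 h).le

/-- Dominated convergence: the Lipschitz constant `C` bounds both terms, and for `r < 1` everything
vanishes outside the 1-thickening of the support. -/
theorem tendsto_eLpNorm_diffQuot_of_smooth {φ : E → ℝ} (hφ : ContDiff ℝ ∞ φ)
    (hφc : HasCompactSupport φ) {θ : E} (hθ : ‖θ‖ = 1) :
    Tendsto (fun r : ℝ => eLpNorm (fun x => diffQuot φ (r • θ) x - inner ℝ (gradient φ x) θ) 2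
      volume) (𝓝[>] 0) (𝓝 0) := by
  obtain ⟨C, hC⟩ := ContDiff.lipschitzWith_of_hasCompactSupport hφc hφ (by simp)
  have hg := continuous_gradient hφ
  have hgC : ∀ x, |inner ℝ (gradient φ x) θ| ≤ C := fun x => by
    rw [inner_gradient_left]
    refine (((fderiv ℝ φ x).le_opNorm θ).trans ?_)
    rw [hθ, mul_one]
    exact norm_fderiv_le_of_lipschitz ℝ hC
  have hD : ∀ r : ℝ, 0 < r → ∀ x, |diffQuot φ (r • θ) x| ≤ C := fun r hr x => by
    rw [diffQuot, abs_div, abs_norm, div_le_iff₀ (by simp [norm_smul, hθ, hr.ne'])]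
    simpa [Real.dist_eq, dist_eq_norm] using hC.dist_le_mul (r • θ + x) x
  set K := Metric.cthickening 1 (tsupport φ)
  have hKc : IsCompact K := hφc.isCompact.cthickening
  have hpow : ∀ f : E → ℝ, eLpNorm f 2 volume = (∫⁻ x, ‖f x‖ₑ ^ 2) ^ (1 / 2 : ℝ) := fun f => by
    rw [eLpNorm_eq_lintegral_rpow_enorm_toReal two_ne_zero (by simp)]
    simp
  simp_rw [hpow]
  suffices h : Tendsto (fun r : ℝ => ∫⁻ x, ‖diffQuot φ (r • θ) x - inner ℝ (gradient φ x) θ‖ₑ ^ 2)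
      (𝓝[>] 0) (𝓝 (∫⁻ _ : E, 0)) by
    rw [lintegral_zero] at h
    have := (ENNReal.continuous_rpow_const (y := 1 / 2)).tendsto 0 |>.comp h
    simpa [Function.comp_def] using this
  refine tendsto_lintegral_filter_of_dominated_convergence
    (K.indicator fun _ => ENNReal.ofReal (2 * C) ^ 2) ?_ ?_ ?_ ?_
  · refine Eventually.of_forall fun r => ?_
    have hc := hφ.continuous
    have : Continuous fun x => diffQuot φ (r • θ) x - inner ℝ (gradient φ x) θ := by
      unfold diffQuot; fun_prop
    exact this.measurable.enorm.pow_const 2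
  · filter_upwards [Ioo_mem_nhdsGT (zero_lt_one (α := ℝ))] with r hr
    refine Eventually.of_forall fun x => ?_
    by_cases hx : x ∈ K
    · rw [Set.indicator_of_mem hx]
      gcongr
      rw [← ofReal_norm, Real.norm_eq_abs]
      refine ENNReal.ofReal_le_ofReal ((abs_sub _ _).trans ?_)
      linarith [hgC x, hD r hr.1 x]
    · have h1 : x ∉ tsupport φ := fun h => hx (Metric.self_subset_cthickening _ h)
      have h2 : r • θ + x ∉ tsupport φ := fun h => hx (Metric.mem_cthickening_of_dist_le x
        (r • θ + x) 1 _ h (by simp [dist_eq_norm, norm_smul, hθ, abs_of_pos hr.1, hr.2.le]))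
      have h3 : x ∉ tsupport (fderiv ℝ φ) := fun h => h1 (tsupport_fderiv_subset ℝ h)
      rw [inner_gradient_left, diffQuot, image_eq_zero_of_notMem_tsupport h1,
        image_eq_zero_of_notMem_tsupport h2, image_eq_zero_of_notMem_tsupport h3]
      simp
  · rw [lintegral_indicator hKc.isClosed.measurableSet, setLIntegral_const]
    exact ENNReal.mul_ne_top (by finiteness) hKc.measure_ne_top
  · refine Eventually.of_forall fun x => ?_
    have h1 := ((hφ.differentiable (by simp) x).hasFDerivAt.hasLineDerivAt θ).tendsto_slope_zero_right
    rw [← inner_gradient_left] at h1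
    have h2 : Tendsto (fun r : ℝ => diffQuot φ (r • θ) x - inner ℝ (gradient φ x) θ) (𝓝[>] 0)
        (𝓝 0) := by
      have h2 := h1.sub_const (inner ℝ (gradient φ x) θ)
      rw [sub_self] at h2
      refine h2.congr' ?_
      filter_upwards [self_mem_nhdsWithin] with r hr
      rw [diffQuot, norm_smul, hθ, mul_one, Real.norm_of_nonneg (Set.mem_Ioi.1 hr).le, smul_eq_mul,
        add_comm x, div_eq_inv_mul]
    simpa [Function.comp_def] using ((ENNReal.continuous_pow 2).tendsto _).comp h2.enorm

theorem eLpNorm_inner_le (g : E → E) {θ : E} (hθ : ‖θ‖ = 1) :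
    eLpNorm (fun x => inner ℝ (g x) θ) 2 volume ≤ eLpNorm g 2 volume :=
  eLpNorm_mono fun x => (norm_inner_le_norm _ _).trans (by rw [hθ, mul_one])

theorem aestronglyMeasurable_diffQuot {u : E → ℝ} (hu : AEStronglyMeasurable u volume) (h : E) :
    AEStronglyMeasurable (diffQuot u h) volume := by
  unfold diffQuot
  simp only [div_eq_mul_inv]
  exact ((hu.comp_measurePreserving (measurePreserving_add_left volume h)).sub hu).mul_const _

/-- Difference quotients converge in `L²` to the directional derivative. -/
theorem IsSobolevLimit.tendsto_eLpNorm_diffQuot {u : E → ℝ} {g : E → E}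
    (hu : IsSobolevLimit u g) {θ : E} (hθ : ‖θ‖ = 1) :
    Tendsto (fun r : ℝ => eLpNorm (fun x => diffQuot u (r • θ) x - inner ℝ (g x) θ) 2
      volume) (𝓝[>] 0) (𝓝 0) := by
  have hu' := hu
  obtain ⟨hu2, hg2, φ, hφ, h1, h2⟩ := hu'
  rw [ENNReal.tendsto_nhds_zero] at h2 ⊢
  intro ε hε
  have hε3 : 0 < ε / 3 := ENNReal.div_pos hε.ne' (by simp)
  obtain ⟨n, hn⟩ := (h2 _ hε3).exists
  have h3 := tendsto_eLpNorm_diffQuot_of_smooth (hφ n).1 (hφ n).2 hθ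
  rw [ENNReal.tendsto_nhds_zero] at h3
  filter_upwards [h3 _ hε3] with r hr
  have hs := hu.sub_smooth (hφ n).1 (hφ n).2
  have hn' : eLpNorm (fun x => g x - gradient (φ n) x) 2 volume ≤ ε / 3 := by
    rw [← eLpNorm_neg]; simpa [Pi.neg_def] using hn
  -- The first and third pieces are controlled by the gradient error of `φ n` uniformly in `r`; only
  -- the smooth middle piece needs `r → 0`.
  have e1 : (fun x => diffQuot u (r • θ) x - inner ℝ (g x) θ) =
      diffQuot (fun x => u x - φ n x) (r • θ) +
      ((fun x => diffQuot (φ n) (r • θ) x - inner ℝ (gradient (φ n) x) θ) +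
       fun x => inner ℝ (gradient (φ n) x - g x) θ) := by
    ext x
    simp only [Pi.add_apply, diffQuot_sub, inner_sub_left]
    ring
  have hgm := (continuous_gradient (hφ n).1).aestronglyMeasurable (μ := volume)
  have m1 := aestronglyMeasurable_diffQuot hs.1.1 (r • θ)
  have m2 : AEStronglyMeasurable
      (fun x => diffQuot (φ n) (r • θ) x - inner ℝ (gradient (φ n) x) θ) volume :=
    (aestronglyMeasurable_diffQuot (hφ n).1.continuous.aestronglyMeasurable _).sub
      (hgm.inner aestronglyMeasurable_const)
  have m3 : AEStronglyMeasurable (fun x => inner ℝ (gradient (φ n) x - g x) θ) volume :=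
    (hgm.sub hg2.1).inner aestronglyMeasurable_const
  rw [e1]
  calc _ ≤ ε / 3 + (ε / 3 + ε / 3) := by
        refine (eLpNorm_add_le m1 (m2.add m3) (by norm_num)).trans ?_
        gcongr
        · exact (hs.eLpNorm_diffQuot_le _).trans hn'
        · refine (eLpNorm_add_le m2 m3 (by norm_num)).trans ?_
          gcongr
          exact (eLpNorm_inner_le _ hθ).trans hn
    _ = ε := by rw [← add_assoc, ENNReal.add_thirds]

end DiffQuot

/-! ### Concentration of the radial measures -/

section RadialLimit

/-- The substitution `r = t ^ (1 / (1 - 2s))` turns the weighted measure into Lebesgue measure and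
moves all dependence on `s` of the measure into the argument of `f`. -/
theorem mul_integral_rpow_mul_eq {s : ℝ} (hs : s < 1 / 2) (f : ℝ → ℝ) :
    (1 - 2 * s) * ∫ r in Set.Ioi (0 : ℝ), r ^ (-(2 * s)) * f r =
      ∫ t in Set.Ioi (0 : ℝ), f (t ^ (1 - 2 * s)⁻¹) := by
  have h0 : 0 < 1 - 2 * s := by linarith
  rw [← integral_const_mul, ← integral_comp_rpow_Ioi_of_pos (inv_pos.2 h0)]
  refine setIntegral_congr_fun measurableSet_Ioi fun t ht => ?_
  have ht : 0 < t := ht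
  have h1 : t ^ ((1 - 2 * s)⁻¹ - 1) * (t ^ (1 - 2 * s)⁻¹) ^ (-(2 * s)) = 1 := by
    rw [← Real.rpow_mul ht.le, ← Real.rpow_add ht]
    have : (1 - 2 * s)⁻¹ - 1 + (1 - 2 * s)⁻¹ * -(2 * s) = 0 := by field_simp; ring
    rw [this, Real.rpow_zero]
  calc _ = ((1 - 2 * s)⁻¹ * (1 - 2 * s)) *
        (t ^ ((1 - 2 * s)⁻¹ - 1) * (t ^ (1 - 2 * s)⁻¹) ^ (-(2 * s))) * f (t ^ (1 - 2 * s)⁻¹) := by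
        simp only [smul_eq_mul]; ring
    _ = _ := by rw [h1, inv_mul_cancel₀ h0.ne', one_mul, one_mul]

/-- The majorant does not depend on `s`: for `t ≤ 1` the bound `A` suffices, and for `t ≥ 1` the
exponent is at least `1`, so the argument is at least `t` and the decay `B / r ^ 2` is inherited. -/
theorem abs_comp_rpow_le {f : ℝ → ℝ} {A B s : ℝ} (hs0 : 0 < s) (hs : s < 1 / 2)
    (hA : ∀ r, 0 < r → |f r| ≤ A) (hB : ∀ r, 0 < r → |f r| ≤ B / r ^ 2) {t : ℝ} (ht : 0 < t) :
    |f (t ^ (1 - 2 * s)⁻¹)| ≤ 2 * (A + B) * (1 + t ^ 2)⁻¹ := by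
  have hA0 : 0 ≤ A := (abs_nonneg _).trans (hA 1 one_pos)
  have hB0 : 0 ≤ B := by simpa using (abs_nonneg _).trans (hB 1 one_pos)
  have hr : 0 < t ^ (1 - 2 * s)⁻¹ := by positivity
  rw [← div_eq_mul_inv, le_div_iff₀ (by positivity)]
  rcases le_total t 1 with h | h
  · have h2 : t ^ 2 ≤ 1 := pow_le_one₀ ht.le h
    nlinarith [hA _ hr, abs_nonneg (f (t ^ (1 - 2 * s)⁻¹))]
  · have h1 : t ≤ t ^ (1 - 2 * s)⁻¹ := by
      conv_lhs => rw [← Real.rpow_one t]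
      exact Real.rpow_le_rpow_of_exponent_le h ((one_le_inv₀ (by linarith)).2 (by linarith))
    have h3 : |f (t ^ (1 - 2 * s)⁻¹)| * t ^ 2 ≤ B := by
      rw [← le_div_iff₀ (by positivity)]
      exact (hB _ hr).trans (by gcongr)
    have h2 : 1 ≤ t ^ 2 := one_le_pow₀ h
    nlinarith [hA _ hr, abs_nonneg (f (t ^ (1 - 2 * s)⁻¹))]

theorem integrable_bound_one_add_sq (C : ℝ) :
    IntegrableOn (fun t : ℝ => C * (1 + t ^ 2)⁻¹) (Set.Ioi 0) :=
  (integrable_inv_one_add_sq.const_mul C).integrableOn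

theorem abs_mul_integral_rpow_mul_le {f : ℝ → ℝ} {A B s : ℝ} (hs0 : 0 < s) (hs : s < 1 / 2)
    (hA : ∀ r, 0 < r → |f r| ≤ A) (hB : ∀ r, 0 < r → |f r| ≤ B / r ^ 2) :
    |(1 - 2 * s) * ∫ r in Set.Ioi (0 : ℝ), r ^ (-(2 * s)) * f r| ≤
      ∫ t in Set.Ioi (0 : ℝ), 2 * (A + B) * (1 + t ^ 2)⁻¹ := by
  rw [mul_integral_rpow_mul_eq hs]
  rw [← Real.norm_eq_abs]
  refine norm_integral_le_of_norm_le (integrable_bound_one_add_sq _) ?_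
  filter_upwards [ae_restrict_mem measurableSet_Ioi] with t ht
  exact abs_comp_rpow_le hs0 hs hA hB ht

/-- The measures `(1 - 2 s) r ^ (-2 s) dr` concentrate at the origin as `s` increases to `1/2`. -/
theorem tendsto_mul_integral_rpow_mul {f : ℝ → ℝ → ℝ} {A B L : ℝ}
    (hm : ∀ s, Measurable (f s))
    (hA : ∀ s, 0 < s → s < 1 / 2 → ∀ r, 0 < r → |f s r| ≤ A)
    (hB : ∀ s, 0 < s → s < 1 / 2 → ∀ r, 0 < r → |f s r| ≤ B / r ^ 2)
    (hL : Tendsto (fun q : ℝ × ℝ => f q.1 q.2) (𝓝[<] (1 / 2) ×ˢ 𝓝[>] 0) (𝓝 L)) :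
    Tendsto (fun s => (1 - 2 * s) * ∫ r in Set.Ioi (0 : ℝ), r ^ (-(2 * s)) * f s r)
      (𝓝[<] (1 / 2)) (𝓝 L) := by
  have hev : ∀ᶠ s : ℝ in 𝓝[<] (1 / 2), 0 < s ∧ s < 1 / 2 := by
    filter_upwards [Ioo_mem_nhdsLT (show (0 : ℝ) < 1 / 2 by norm_num)] with s hs using hs
  have hp : Tendsto (fun s : ℝ => (1 - 2 * s)⁻¹) (𝓝[<] (1 / 2)) atTop := by
    refine tendsto_inv_nhdsGT_zero.comp (tendsto_nhdsWithin_iff.2 ⟨?_, ?_⟩)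
    · have : Tendsto (fun s : ℝ => 1 - 2 * s) (𝓝 (1 / 2)) (𝓝 (1 - 2 * (1 / 2))) :=
        Continuous.tendsto (by fun_prop) _
      norm_num at this
      exact this.mono_left nhdsWithin_le_nhds
    · filter_upwards [hev] with s hs
      simp only [Set.mem_Ioi]; linarith
  -- As `s → 1/2` the exponent tends to infinity: the argument tends to `0` for `t < 1`, where `f`
  -- tends to `L`, and to infinity for `t > 1`, where `f` decays. The limit integrand is `L` on `(0,
  -- 1)`.
  have hlim : ∫ t in Set.Ioi (0 : ℝ), (Set.Iio (1 : ℝ)).indicator (fun _ => L) t = L := by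
    rw [setIntegral_indicator measurableSet_Iio, Set.Ioi_inter_Iio]
    simp
  rw [← hlim]
  have hcongr : (fun s => ∫ t in Set.Ioi (0 : ℝ), f s (t ^ (1 - 2 * s)⁻¹)) =ᶠ[𝓝[<] (1 / 2)]
      (fun s => (1 - 2 * s) * ∫ r in Set.Ioi (0 : ℝ), r ^ (-(2 * s)) * f s r) := by
    filter_upwards [hev] with s hs
    rw [mul_integral_rpow_mul_eq hs.2]
  refine Tendsto.congr' hcongr ?_
  refine tendsto_integral_filter_of_dominated_convergence
    (fun t => 2 * (A + B) * (1 + t ^ 2)⁻¹) ?_ ?_ (integrable_bound_one_add_sq _) ?_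
  · exact Eventually.of_forall fun s => ((hm s).comp (by fun_prop)).aestronglyMeasurable
  · filter_upwards [hev] with s hs
    filter_upwards [ae_restrict_mem measurableSet_Ioi] with t ht
    exact abs_comp_rpow_le hs.1 hs.2 (hA s hs.1 hs.2) (hB s hs.1 hs.2) ht
  · have h1 : ∀ᵐ t : ℝ ∂volume.restrict (Set.Ioi 0), t ≠ 1 := by
      refine ae_restrict_of_ae ?_
      simp [ae_iff]
    filter_upwards [h1, ae_restrict_mem measurableSet_Ioi] with t ht1 ht0
    have ht0 : 0 < t := ht0
    rcases lt_or_gt_of_ne ht1 with ht | ht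
    · rw [Set.indicator_of_mem (Set.mem_Iio.2 ht)]
      refine hL.comp (tendsto_id.prodMk (tendsto_nhdsWithin_iff.2 ⟨?_, ?_⟩))
      · exact (tendsto_rpow_atTop_of_base_lt_one t (by linarith) ht).comp hp
      · exact Eventually.of_forall fun s => Real.rpow_pos_of_pos ht0 _
    · rw [Set.indicator_of_notMem (by simpa using ht.le)]
      have h2 : Tendsto (fun s : ℝ => t ^ (1 - 2 * s)⁻¹) (𝓝[<] (1 / 2)) atTop :=
        (tendsto_rpow_atTop_of_base_gt_one t ht).comp hp
      have h3 : Tendsto (fun s : ℝ => B / (t ^ (1 - 2 * s)⁻¹) ^ 2) (𝓝[<] (1 / 2)) (𝓝 0) :=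
        ((tendsto_pow_atTop two_ne_zero).comp h2).const_div_atTop B
      refine squeeze_zero_norm' ?_ h3
      filter_upwards [hev] with s hs
      exact hB s hs.1 hs.2 _ (Real.rpow_pos_of_pos ht0 _)

theorem integrableOn_rpow_mul_min {A B s : ℝ} (hA : 0 ≤ A) (hB : 0 ≤ B) (hs0 : 0 < s) (hs : s < 1 / 2) :
    IntegrableOn (fun r : ℝ => r ^ (-(2 * s)) * min A (B / r ^ 2)) (Set.Ioi 0) := by
  have hmeas : ∀ μ : Measure ℝ,
      AEStronglyMeasurable (fun r : ℝ => r ^ (-(2 * s)) * min A (B / r ^ 2)) μ := fun μ => by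
    refine Measurable.aestronglyMeasurable ?_
    fun_prop
  rw [← Set.Ioc_union_Ioi_eq_Ioi (zero_le_one (α := ℝ))]
  refine IntegrableOn.union ?_ ?_
  · have h1 : IntegrableOn (fun r : ℝ => A * r ^ (-(2 * s))) (Set.Ioc 0 1) :=
      (intervalIntegral.intervalIntegrable_rpow' (by linarith)).1.const_mul A
    refine h1.mono' (hmeas _) ?_
    filter_upwards [ae_restrict_mem measurableSet_Ioc] with r hr
    have hr0 : 0 < r := hr.1
    rw [Real.norm_of_nonneg (by positivity), mul_comm]
    gcongr
    exact min_le_left _ _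
  · have h1 : IntegrableOn (fun r : ℝ => B * r ^ (-(2 * s) - 2)) (Set.Ioi 1) :=
      (integrableOn_Ioi_rpow_of_lt (by linarith) one_pos).const_mul B
    refine h1.mono' (hmeas _) ?_
    filter_upwards [ae_restrict_mem measurableSet_Ioi] with r hr
    have hr0 : 0 < r := one_pos.trans hr
    rw [Real.norm_of_nonneg (by positivity), Real.rpow_sub hr0, Real.rpow_two]
    calc _ ≤ r ^ (-(2 * s)) * (B / r ^ 2) := by gcongr; exact min_le_right _ _
      _ = _ := by ring

end RadialLimit

/-! ### The form restricted to a fixed increment -/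

section Form

variable {E : Type*}

/-- The weight `1_Ω(x) (1 + 1_{Ωᶜ}(y))`. -/
noncomputable def interactionWeight (Ω : Set E) (y x : E) : ℝ :=
  Ω.indicator 1 x * (1 + Ωᶜ.indicator 1 y)

theorem abs_interactionWeight_le (Ω : Set E) (y x : E) : |interactionWeight Ω y x| ≤ 2 := by
  unfold interactionWeight
  by_cases hx : x ∈ Ω <;> by_cases hy : y ∈ Ω <;> simp [hx, hy]
  norm_num

theorem enorm_interactionWeight_le (Ω : Set E) (y x : E) : ‖interactionWeight Ω y x‖ₑ ≤ 2 := by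
  rw [← ofReal_norm, ← ENNReal.ofReal_ofNat 2]
  exact ENNReal.ofReal_le_ofReal (abs_interactionWeight_le Ω y x)

theorem enorm_GTilde_le_one (d : ℕ) {s : ℝ} (hs : 0 ≤ s) (ρ : ℝ) : ‖GTilde d s ρ‖ₑ ≤ 1 := by
  rw [← ofReal_norm, ← ENNReal.ofReal_one]
  exact ENNReal.ofReal_le_ofReal (abs_GTilde_le_one d hs ρ)

variable [NormedAddCommGroup E]

/-- Since `Ω` is open, a point of `Ω` stays in `Ω` under small shifts, so the doubled pairs
disappear in the limit. -/
theorem tendsto_interactionWeight {Ω : Set E} (hΩ : IsOpen Ω) {ι : Type*} {l : Filter ι}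
    {h : ι → E} (hh : Tendsto h l (𝓝 0)) (x : E) :
    Tendsto (fun i => interactionWeight Ω (h i + x) x) l (𝓝 (Ω.indicator 1 x)) := by
  by_cases hx : x ∈ Ω
  · refine tendsto_const_nhds.congr' ?_
    have h1 : Tendsto (fun i => h i + x) l (𝓝 x) := by simpa using hh.add_const x
    filter_upwards [h1.eventually_mem (hΩ.mem_nhds hx)] with i hi
    simp [interactionWeight, hx, hi]
  · simpa [interactionWeight, hx] using tendsto_const_nhds

/-- The part of the form `a_u(u,v)` coming from pairs of points which differ by `h`. -/
noncomputable def sliceForm [MeasureSpace E] (d : ℕ) (s : ℝ) (Ω : Set E) (u v : E → ℝ) (h : E) : ℝ :=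
  ∫ x, interactionWeight Ω (h + x) x *
    (GTilde d s (diffQuot u h x) * diffQuot u h x * diffQuot v h x)

theorem lintegral_enorm_mul_le {α : Type*} [MeasurableSpace α] {μ : Measure α} {f g : α → ℝ}
    (hf : AEStronglyMeasurable f μ) (hg : AEStronglyMeasurable g μ) :
    ∫⁻ x, ‖f x‖ₑ * ‖g x‖ₑ ∂μ ≤ eLpNorm f 2 μ * eLpNorm g 2 μ := by
  have := eLpNorm_smul_le_mul_eLpNorm (p := 2) (q := 2) (r := 1) hg hf
  rw [eLpNorm_one_eq_lintegral_enorm] at this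
  simpa using this

theorem enorm_sliceForm_integrand_le (d : ℕ) {s : ℝ} (hs : 0 ≤ s) (Ω : Set E) (u v : E → ℝ)
    (h x : E) :
    ‖interactionWeight Ω (h + x) x *
      (GTilde d s (diffQuot u h x) * diffQuot u h x * diffQuot v h x)‖ₑ ≤
      2 * (‖diffQuot u h x‖ₑ * ‖diffQuot v h x‖ₑ) := by
  rw [enorm_mul, enorm_mul, enorm_mul]
  gcongr
  · exact enorm_interactionWeight_le _ _ _
  · exact mul_le_of_le_one_left' (enorm_GTilde_le_one d hs _)

variable [MeasurableSpace E] [BorelSpace E]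

theorem measurable_interactionWeight {Ω : Set E} (hΩ : IsOpen Ω) :
    Measurable fun p : E × E => interactionWeight Ω p.1 p.2 := by
  unfold interactionWeight
  exact ((measurable_one.indicator hΩ.measurableSet).comp measurable_snd).mul
    (measurable_const.add ((measurable_one.indicator hΩ.measurableSet.compl).comp measurable_fst))

variable [InnerProductSpace ℝ E] [FiniteDimensional ℝ E]

theorem measurable_diffQuot {u : E → ℝ} (hu : Measurable u) :
    Measurable fun p : E × E => diffQuot u p.1 p.2 := by
  unfold diffQuot
  fun_prop

theorem measurable_sliceForm_integrand (d : ℕ) (s : ℝ) {Ω : Set E} (hΩ : IsOpen Ω) {u v : E → ℝ}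
    (hu : Measurable u) (hv : Measurable v) :
    Measurable fun p : E × E => interactionWeight Ω (p.1 + p.2) p.2 *
      (GTilde d s (diffQuot u p.1 p.2) * diffQuot u p.1 p.2 * diffQuot v p.1 p.2) := by
  have h1 := (measurable_interactionWeight hΩ).comp
    ((measurable_fst.add measurable_snd).prodMk measurable_snd : Measurable fun p : E × E =>
      (p.1 + p.2, p.2))
  exact h1.mul ((((continuous_GTilde_right d s).measurable.comp (measurable_diffQuot hu)).mul
    (measurable_diffQuot hu)).mul (measurable_diffQuot hv))

theorem measurable_sliceForm (d : ℕ) (s : ℝ) {Ω : Set E} (hΩ : IsOpen Ω) {u v : E → ℝ}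
    (hu : Measurable u) (hv : Measurable v) : Measurable (sliceForm d s Ω u v) :=
  ((measurable_sliceForm_integrand d s hΩ hu hv).stronglyMeasurable.integral_prod_right').measurable

theorem enorm_sliceForm_le (d : ℕ) {s : ℝ} (hs : 0 ≤ s) (Ω : Set E) {u v : E → ℝ}
    (hu : AEStronglyMeasurable u volume) (hv : AEStronglyMeasurable v volume) (h : E) :
    ‖sliceForm d s Ω u v h‖ₑ ≤
      2 * (eLpNorm (diffQuot u h) 2 volume * eLpNorm (diffQuot v h) 2 volume) := by
  refine (enorm_integral_le_lintegral_enorm _).trans ?_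
  refine (lintegral_mono fun x => enorm_sliceForm_integrand_le d hs Ω u v h x).trans ?_
  rw [lintegral_const_mul' _ _ (by simp)]
  gcongr
  exact lintegral_enorm_mul_le (aestronglyMeasurable_diffQuot hu h)
    (aestronglyMeasurable_diffQuot hv h)

/-- The product `GTilde d s a * a` is treated as a single 1-Lipschitz function of `a`, so that
errors in the argument of the weight cost no more than errors in a linear factor. -/
theorem GTilde_mul_sub_mul_le (d : ℕ) {s : ℝ} (hs : 0 ≤ s) (a b p r : ℝ) :
    ‖GTilde d s a * a * b - GTilde d s p * p * r‖ₑ ≤ ‖a - p‖ₑ * ‖b‖ₑ + ‖p‖ₑ * ‖b - r‖ₑ := by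
  have e : GTilde d s a * a * b - GTilde d s p * p * r =
      (GTilde d s a * a - GTilde d s p * p) * b + GTilde d s p * p * (b - r) := by ring
  rw [e]
  refine (enorm_add_le _ _).trans ?_
  rw [enorm_mul, enorm_mul]
  gcongr
  · exact enorm_le_iff_norm_le.2 (abs_GTilde_mul_self_sub_le d hs a p)
  · refine enorm_le_iff_norm_le.2 ?_
    rw [norm_mul]
    exact mul_le_of_le_one_left (norm_nonneg _) (abs_GTilde_le_one d hs p)

theorem integrable_interactionWeight_mul (d : ℕ) {s : ℝ} (hs : 0 ≤ s) {Ω : Set E} (hΩ : IsOpen Ω)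
    {f g : E → ℝ} (hf : MemLp f 2 volume) (hg : MemLp g 2 volume) (h : E) :
    Integrable fun x => interactionWeight Ω (h + x) x * (GTilde d s (f x) * f x * g x) := by
  have hw : Measurable fun x => interactionWeight Ω (h + x) x :=
    (measurable_interactionWeight hΩ).comp ((measurable_const_add h).prodMk measurable_id)
  have hfg : Integrable (fun x => f x * g x) := hf.integrable_mul hg
  refine (hfg.norm.const_mul 2).mono' ?_ (Eventually.of_forall fun x => ?_)
  · exact hw.aestronglyMeasurable.mul
      ((((continuous_GTilde_right d s).comp_aestronglyMeasurable hf.1).mul hf.1).mul hg.1)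
  · rw [norm_mul, mul_assoc (GTilde d s (f x)), norm_mul (GTilde d s (f x))]
    gcongr
    · exact abs_interactionWeight_le _ _ _
    · exact mul_le_of_le_one_left (norm_nonneg _) (abs_GTilde_le_one d hs _)

theorem IsSobolevLimit.memLp_diffQuot {u : E → ℝ} {g : E → E} (hu : IsSobolevLimit u g) (h : E) :
    MemLp (diffQuot u h) 2 volume :=
  ⟨aestronglyMeasurable_diffQuot hu.1.1 h,
    (hu.eLpNorm_diffQuot_le h).trans_lt hu.2.1.eLpNorm_lt_top⟩

theorem memLp_inner_const {g : E → E} (hg : MemLp g 2 volume) (θ : E) :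
    MemLp (fun x => inner ℝ (g x) θ) 2 volume := by
  refine hg.of_le_mul (c := ‖θ‖) (hg.1.inner aestronglyMeasurable_const)
    (Eventually.of_forall fun x => ?_)
  rw [mul_comm]
  exact norm_inner_le_norm _ _

/-- The right side is free of `s`, which is what permits a joint limit in `s` and `r`. -/
theorem enorm_sliceForm_sub_le (d : ℕ) {s : ℝ} (hs : 0 ≤ s) {Ω : Set E} (hΩ : IsOpen Ω)
    {u v : E → ℝ} {gu gv : E → E} (hu : IsSobolevLimit u gu) (hv : IsSobolevLimit v gv) (h : E)
    {θ : E} (hθ : ‖θ‖ = 1) :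
    ‖sliceForm d s Ω u v h - ∫ x, interactionWeight Ω (h + x) x *
      (GTilde d s (inner ℝ (gu x) θ) * inner ℝ (gu x) θ * inner ℝ (gv x) θ)‖ₑ ≤
      2 * (eLpNorm (fun x => diffQuot u h x - inner ℝ (gu x) θ) 2 volume * eLpNorm gv 2 volume +
        eLpNorm gu 2 volume * eLpNorm (fun x => diffQuot v h x - inner ℝ (gv x) θ) 2 volume) := by
  have mu := hu.memLp_diffQuot h
  have mv := hv.memLp_diffQuot h
  have nu := memLp_inner_const hu.2.1 θ
  have nv := memLp_inner_const hv.2.1 θ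
  rw [sliceForm, ← integral_sub (integrable_interactionWeight_mul d hs hΩ mu mv h)
    (integrable_interactionWeight_mul d hs hΩ nu nv h)]
  refine (enorm_integral_le_lintegral_enorm _).trans ?_
  have hpt : ∀ x, ‖interactionWeight Ω (h + x) x *
        (GTilde d s (diffQuot u h x) * diffQuot u h x * diffQuot v h x) -
      interactionWeight Ω (h + x) x *
      (GTilde d s (inner ℝ (gu x) θ) * inner ℝ (gu x) θ * inner ℝ (gv x) θ)‖ₑ ≤
      2 * (‖diffQuot u h x - inner ℝ (gu x) θ‖ₑ * ‖diffQuot v h x‖ₑ +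
        ‖inner ℝ (gu x) θ‖ₑ * ‖diffQuot v h x - inner ℝ (gv x) θ‖ₑ) := fun x => by
    rw [← mul_sub, enorm_mul]
    gcongr
    · exact enorm_interactionWeight_le _ _ _
    · exact GTilde_mul_sub_mul_le d hs _ _ _ _
  refine (lintegral_mono hpt).trans ?_
  rw [lintegral_const_mul' _ _ (by simp), lintegral_add_left'
    (f := fun x => ‖diffQuot u h x - inner ℝ (gu x) θ‖ₑ * ‖diffQuot v h x‖ₑ)
    ((mu.1.sub nu.1).enorm.mul mv.1.enorm)]
  gcongr
  · refine (lintegral_enorm_mul_le (mu.1.sub nu.1) mv.1).trans ?_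
    gcongr
    · exact le_rfl
    · exact hv.eLpNorm_diffQuot_le h
  · refine (lintegral_enorm_mul_le nu.1 (mv.1.sub nv.1)).trans ?_
    gcongr
    · exact eLpNorm_inner_le gu hθ
    · exact le_rfl

theorem tendsto_sliceForm (d : ℕ) {Ω : Set E} (hΩ : IsOpen Ω)
    {u v : E → ℝ} {gu gv : E → E} (hu : IsSobolevLimit u gu) (hv : IsSobolevLimit v gv)
    {θ : E} (hθ : ‖θ‖ = 1) :
    Tendsto (fun q : ℝ × ℝ => sliceForm d q.1 Ω u v (q.2 • θ)) (𝓝[<] (1 / 2) ×ˢ 𝓝[>] 0)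
      (𝓝 (∫ x in Ω, GTilde d (1 / 2) (inner ℝ (gu x) θ) * inner ℝ (gu x) θ *
        inner ℝ (gv x) θ)) := by
  have hev : ∀ᶠ q : ℝ × ℝ in 𝓝[<] (1 / 2) ×ˢ 𝓝[>] 0, 0 ≤ q.1 := by
    have : ∀ᶠ s : ℝ in 𝓝[<] (1 / 2), 0 ≤ s := by
      filter_upwards [Ioo_mem_nhdsLT (show (0 : ℝ) < 1 / 2 by norm_num)] with s hs using hs.1.le
    exact tendsto_fst.eventually this
  have nu := memLp_inner_const hu.2.1 θ
  have nv := memLp_inner_const hv.2.1 θ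
  -- `T` already has directional derivatives in place of difference quotients, while `s` and the
  -- shifted weight still vary; its limit is then plain dominated convergence.
  set T : ℝ × ℝ → ℝ := fun q => ∫ x, interactionWeight Ω (q.2 • θ + x) x *
    (GTilde d q.1 (inner ℝ (gu x) θ) * inner ℝ (gu x) θ * inner ℝ (gv x) θ)
  have h1 : Tendsto (fun q : ℝ × ℝ => sliceForm d q.1 Ω u v (q.2 • θ) - T q)
      (𝓝[<] (1 / 2) ×ˢ 𝓝[>] 0) (𝓝 0) := by
    rw [tendsto_zero_iff_enorm_tendsto_zero]
    have hb : Tendsto (fun q : ℝ × ℝ =>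
        2 * (eLpNorm (fun x => diffQuot u (q.2 • θ) x - inner ℝ (gu x) θ) 2 volume *
          eLpNorm gv 2 volume + eLpNorm gu 2 volume *
          eLpNorm (fun x => diffQuot v (q.2 • θ) x - inner ℝ (gv x) θ) 2 volume))
        (𝓝[<] (1 / 2) ×ˢ 𝓝[>] 0)
        (𝓝 (2 * (0 * eLpNorm gv 2 volume + eLpNorm gu 2 volume * 0))) := by
      refine ENNReal.Tendsto.const_mul (Tendsto.add ?_ ?_) (by simp)
      · exact ENNReal.Tendsto.mul_const ((hu.tendsto_eLpNorm_diffQuot hθ).comp tendsto_snd)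
          (Or.inr hv.2.1.eLpNorm_ne_top)
      · exact ENNReal.Tendsto.const_mul ((hv.tendsto_eLpNorm_diffQuot hθ).comp tendsto_snd)
          (Or.inr hu.2.1.eLpNorm_ne_top)
    simp only [zero_mul, mul_zero, add_zero] at hb
    refine tendsto_of_tendsto_of_tendsto_of_le_of_le' tendsto_const_nhds hb
      (Eventually.of_forall fun _ => zero_le) ?_
    filter_upwards [hev] with q hq
    exact enorm_sliceForm_sub_le d hq hΩ hu hv _ hθ
  have h2 : Tendsto T (𝓝[<] (1 / 2) ×ˢ 𝓝[>] 0)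
      (𝓝 (∫ x in Ω, GTilde d (1 / 2) (inner ℝ (gu x) θ) * inner ℝ (gu x) θ *
        inner ℝ (gv x) θ)) := by
    rw [← integral_indicator hΩ.measurableSet]
    have hint : Integrable (fun x => inner ℝ (gu x) θ * inner ℝ (gv x) θ) := nu.integrable_mul nv
    refine tendsto_integral_filter_of_dominated_convergence
      (fun x => 2 * ‖inner ℝ (gu x) θ * inner ℝ (gv x) θ‖) ?_ ?_ (hint.norm.const_mul 2) ?_
    · filter_upwards [hev] with q hq
      exact (integrable_interactionWeight_mul d hq hΩ nu nv _).1
    · filter_upwards [hev] with q hq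
      refine Eventually.of_forall fun x => ?_
      rw [norm_mul, mul_assoc (GTilde d q.1 _), norm_mul (GTilde d q.1 _)]
      gcongr
      · exact abs_interactionWeight_le _ _ _
      · exact mul_le_of_le_one_left (norm_nonneg _) (abs_GTilde_le_one d hq _)
    · refine Eventually.of_forall fun x => ?_
      have hr : Tendsto (fun q : ℝ × ℝ => q.2 • θ) (𝓝[<] (1 / 2) ×ˢ 𝓝[>] 0) (𝓝 0) := by
        have : Tendsto (fun r : ℝ => r • θ) (𝓝[>] 0) (𝓝 ((0 : ℝ) • θ)) :=
          (Continuous.tendsto (by fun_prop) _).mono_left nhdsWithin_le_nhds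
        rw [zero_smul] at this
        exact this.comp tendsto_snd
      have hG : Tendsto (fun q : ℝ × ℝ => GTilde d q.1 (inner ℝ (gu x) θ))
          (𝓝[<] (1 / 2) ×ˢ 𝓝[>] 0) (𝓝 (GTilde d (1 / 2) (inner ℝ (gu x) θ))) := by
        have hc : Continuous fun s : ℝ => GTilde d s (inner ℝ (gu x) θ) :=
          (continuous_GTilde d).comp (Continuous.prodMk_left _)
        exact ((hc.tendsto (1 / 2)).mono_left nhdsWithin_le_nhds).comp tendsto_fst
      have := (tendsto_interactionWeight hΩ hr x).mul
        ((hG.mul_const (inner ℝ (gu x) θ)).mul_const (inner ℝ (gv x) θ))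
      refine this.trans_eq ?_
      by_cases hx : x ∈ Ω <;> simp [hx]
  simpa using h1.add h2

end Form

/-! ### Assembling the form and passing to the limit -/

section Limit

/-- `A` comes from the `L²` norms of the gradients and `B` from those of `u` and `v`. The minimum
makes the radial integral converge both at the origin and at infinity. -/
theorem IsSobolevLimit.exists_eLpNorm_diffQuot_mul_le {E : Type*} [NormedAddCommGroup E]
    [InnerProductSpace ℝ E] [FiniteDimensional ℝ E] [MeasurableSpace E] [BorelSpace E]
    {u v : E → ℝ} {gu gv : E → E} (hu : IsSobolevLimit u gu) (hv : IsSobolevLimit v gv) :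
    ∃ A B : ℝ, 0 ≤ A ∧ 0 ≤ B ∧ ∀ h : E,
      2 * (eLpNorm (diffQuot u h) 2 volume * eLpNorm (diffQuot v h) 2 volume) ≤
        ENNReal.ofReal (min A (B / ‖h‖ ^ 2)) := by
  have hA : 2 * (eLpNorm gu 2 volume * eLpNorm gv 2 volume) ≠ ⊤ :=
    ENNReal.mul_ne_top (by simp) (ENNReal.mul_ne_top hu.2.1.eLpNorm_ne_top hv.2.1.eLpNorm_ne_top)
  have hB : 2 * ((2 * eLpNorm u 2 volume) * (2 * eLpNorm v 2 volume)) ≠ ⊤ :=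
    ENNReal.mul_ne_top (by simp) (ENNReal.mul_ne_top
      (ENNReal.mul_ne_top (by simp) hu.1.eLpNorm_ne_top)
      (ENNReal.mul_ne_top (by simp) hv.1.eLpNorm_ne_top))
  refine ⟨(2 * (eLpNorm gu 2 volume * eLpNorm gv 2 volume)).toReal,
    (2 * ((2 * eLpNorm u 2 volume) * (2 * eLpNorm v 2 volume))).toReal,
    ENNReal.toReal_nonneg, ENNReal.toReal_nonneg, fun h => ?_⟩
  rw [ENNReal.ofReal_min, le_min_iff]
  constructor
  · rw [ENNReal.ofReal_toReal hA]
    gcongr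
    · exact hu.eLpNorm_diffQuot_le h
    · exact hv.eLpNorm_diffQuot_le h
  · rcases eq_or_ne h 0 with rfl | hh
    · have : diffQuot u 0 = 0 := by ext x; simp [diffQuot]
      simp [this]
    · have hpos : 0 < ‖h‖ := norm_pos_iff.2 hh
      rw [ENNReal.ofReal_div_of_pos (by positivity), ENNReal.ofReal_toReal hB,
        ENNReal.ofReal_pow (norm_nonneg _), ofReal_norm]
      calc _ ≤ 2 * ((‖h‖ₑ⁻¹ * (2 * eLpNorm u 2 volume)) * (‖h‖ₑ⁻¹ * (2 * eLpNorm v 2 volume))) := by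
            gcongr
            · exact eLpNorm_diffQuot_le_of_memLp hu.1 h
            · exact eLpNorm_diffQuot_le_of_memLp hv.1 h
        _ = _ := by
            rw [div_eq_mul_inv, ENNReal.inv_pow]
            ring

variable {d : ℕ}

local notation "𝔼" => EuclideanSpace ℝ (Fin d)

/-- Two powers of `‖h‖` in the kernel are absorbed by the difference quotients of the two linear
factors. At `h = 0` both sides vanish. -/
theorem formIntegrand_add_left (s : ℝ) (u v : 𝔼 → ℝ) (h x : 𝔼) :
    formIntegrand s u u v (h + x, x) = ‖h‖ ^ (-((d : ℝ) - 1 + 2 * s)) *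
      (GTilde d s (diffQuot u h x) * diffQuot u h x * diffQuot v h x) := by
  rcases eq_or_ne h 0 with rfl | hh
  · simp [formIntegrand, diffQuot]
  · have hpos : 0 < ‖h‖ := norm_pos_iff.2 hh
    simp only [formIntegrand, diffQuot, add_sub_cancel_right]
    rw [show (d : ℝ) + 1 + 2 * s = ((d : ℝ) - 1 + 2 * s) + 2 by ring, Real.rpow_add hpos,
      Real.rpow_neg hpos.le, Real.rpow_two]
    field_simp

theorem formIntegrand_swap (s : ℝ) (u v : 𝔼 → ℝ) (p : 𝔼 × 𝔼) :
    formIntegrand s u u v p.swap = formIntegrand s u u v p := by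
  simp only [formIntegrand, Prod.fst_swap, Prod.snd_swap, norm_sub_rev p.2 p.1, GTilde]
  congr 1
  · congr 1 with r
    rw [← neg_sub (u p.1) (u p.2), neg_div, neg_sq]
  · ring_nf

theorem measurable_formIntegrand (s : ℝ) {u v : 𝔼 → ℝ} (hu : Measurable u) (hv : Measurable v) :
    Measurable (formIntegrand s u u v) := by
  unfold formIntegrand
  exact ((continuous_GTilde_right d s).measurable.comp (by fun_prop)).mul (by fun_prop)

theorem integrable_rpow_norm_mul_min (hd : 1 ≤ d) {A B s : ℝ} (hA : 0 ≤ A) (hB : 0 ≤ B)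
    (hs0 : 0 < s) (hs : s < 1 / 2) :
    Integrable (fun h : 𝔼 => ‖h‖ ^ (-((d : ℝ) - 1 + 2 * s)) * min A (B / ‖h‖ ^ 2)) := by
  have : Nontrivial 𝔼 := Module.nontrivial_of_finrank_pos (R := ℝ) (by simpa using Nat.pos_of_ne_zero (by omega))
  rw [integrable_fun_norm_addHaar volume
    (f := fun r => r ^ (-((d : ℝ) - 1 + 2 * s)) * min A (B / r ^ 2)), finrank_euclideanSpace_fin]
  refine (integrableOn_rpow_mul_min hA hB hs0 hs).congr_fun (fun r hr => ?_) measurableSet_Ioi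
  have hr : 0 < r := hr
  have e : -(2 * s) = ((d - 1 : ℕ) : ℝ) + -((d : ℝ) - 1 + 2 * s) := by
    rw [Nat.cast_sub hd]; push_cast; ring
  beta_reduce
  rw [smul_eq_mul, e, Real.rpow_add hr, Real.rpow_natCast, mul_assoc]

/-- Tonelli with the increment as outer variable; Cauchy–Schwarz in `x` reduces the claim to
`integrable_rpow_norm_mul_min`. -/
theorem integrable_formIntegrand_add_left (hd : 1 ≤ d) {s : ℝ} (hs0 : 0 < s) (hs : s < 1 / 2)
    {u v : 𝔼 → ℝ} {gu gv : 𝔼 → 𝔼} (hum : Measurable u) (hvm : Measurable v)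
    (hu : IsSobolevLimit u gu) (hv : IsSobolevLimit v gv) :
    Integrable (fun p : 𝔼 × 𝔼 => formIntegrand s u u v (p.1 + p.2, p.2)) := by
  have hmeas : Measurable (fun p : 𝔼 × 𝔼 => formIntegrand s u u v (p.1 + p.2, p.2)) :=
    (measurable_formIntegrand s hum hvm).comp (by fun_prop)
  obtain ⟨A, B, hA, hB, hAB⟩ := hu.exists_eLpNorm_diffQuot_mul_le hv
  refine ⟨hmeas.aestronglyMeasurable, ?_⟩
  rw [hasFiniteIntegral_iff_enorm, Measure.volume_eq_prod, lintegral_prod _ hmeas.enorm.aemeasurable]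
  refine lt_of_le_of_lt (lintegral_mono fun h => ?_)
    (integrable_rpow_norm_mul_min hd hA hB hs0 hs).lintegral_lt_top
  simp only [formIntegrand_add_left]
  simp_rw [enorm_mul (‖h‖ ^ (-((d : ℝ) - 1 + 2 * s)))]
  rw [lintegral_const_mul' _ _ (by simp), ENNReal.ofReal_mul (by positivity),
    Real.enorm_of_nonneg (by positivity)]
  gcongr
  refine le_trans ?_ (hAB h)
  refine (lintegral_mono fun x => ?_).trans ((lintegral_enorm_mul_le
    (aestronglyMeasurable_diffQuot hu.1.1 h) (aestronglyMeasurable_diffQuot hv.1.1 h)).trans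
      (le_mul_of_one_le_left' one_le_two))
  rw [enorm_mul, enorm_mul]
  gcongr
  exact mul_le_of_le_one_left' (enorm_GTilde_le_one d hs0.le _)

theorem integrable_formIntegrand (hd : 1 ≤ d) {s : ℝ} (hs0 : 0 < s) (hs : s < 1 / 2)
    {u v : 𝔼 → ℝ} {gu gv : 𝔼 → 𝔼} (hum : Measurable u) (hvm : Measurable v)
    (hu : IsSobolevLimit u gu) (hv : IsSobolevLimit v gv) :
    Integrable (formIntegrand s u u v) :=
  ((measurePreserving_add_prod volume volume).integrable_comp
    (measurable_formIntegrand s hum hvm).aestronglyMeasurable).1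
      (integrable_formIntegrand_add_left hd hs0 hs hum hvm hu hv)

/-- The interaction set is the disjoint union of `univ ×ˢ Ω` and `Ω ×ˢ Ωᶜ`. By symmetry the second
part may be replaced by its mirror image `Ωᶜ ×ˢ Ω`, so that the second point always lies in `Ω`. -/
theorem setIntegral_interactionSet_eq {Ω : Set 𝔼} (hΩ : IsOpen Ω) {f : 𝔼 × 𝔼 → ℝ}
    (hf : Integrable f) (hsymm : ∀ p, f p.swap = f p) :
    ∫ p in interactionSet Ω, f p = ∫ p, interactionWeight Ω p.1 p.2 * f p := by
  have hΩm := hΩ.measurableSet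
  have hQ : MeasurableSet (interactionSet Ω) := (hΩm.compl.prod hΩm.compl).compl
  have m1 : MeasurableSet (Set.univ ×ˢ Ω : Set (𝔼 × 𝔼)) := MeasurableSet.univ.prod hΩm
  have m2 : MeasurableSet (Ω ×ˢ Ωᶜ : Set (𝔼 × 𝔼)) := hΩm.prod hΩm.compl
  have m3 : MeasurableSet (Ωᶜ ×ˢ Ω : Set (𝔼 × 𝔼)) := hΩm.compl.prod hΩm
  have e1 : ∀ p, (interactionSet Ω).indicator f p =
      (Set.univ ×ˢ Ω).indicator f p + (Ω ×ˢ Ωᶜ).indicator f p := fun p => by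
    by_cases h1 : p.1 ∈ Ω <;> by_cases h2 : p.2 ∈ Ω <;>
      simp [Set.indicator, interactionSet, Set.mem_prod, h1, h2]
  have e2 : ∀ p, interactionWeight Ω p.1 p.2 * f p =
      (Set.univ ×ˢ Ω).indicator f p + (Ωᶜ ×ˢ Ω).indicator f p := fun p => by
    by_cases h1 : p.1 ∈ Ω <;> by_cases h2 : p.2 ∈ Ω <;>
      simp [Set.indicator, interactionWeight, Set.mem_prod, h1, h2]
    ring
  have e3 : ∀ p : 𝔼 × 𝔼, (Ωᶜ ×ˢ Ω).indicator f p = (Ω ×ˢ Ωᶜ).indicator f p.swap := fun p => by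
    by_cases h1 : p.1 ∈ Ω <;> by_cases h2 : p.2 ∈ Ω <;>
      simp [Set.indicator, Set.mem_prod, h1, h2, hsymm p]
  rw [← integral_indicator hQ]
  simp_rw [e1, e2]
  rw [integral_add (hf.indicator m1) (hf.indicator m2),
    integral_add (hf.indicator m1) (hf.indicator m3)]
  simp_rw [e3]
  congr 1
  rw [Measure.volume_eq_prod]
  exact (integral_prod_swap _).symm

/-- The shear `(h, x) ↦ (h + x, x)` preserves volume, and Fubini then integrates out `x`. -/
theorem integrable_and_setIntegral_formIntegrand (hd : 1 ≤ d) {s : ℝ} (hs0 : 0 < s)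
    (hs : s < 1 / 2) {Ω : Set 𝔼} (hΩ : IsOpen Ω) {u v : 𝔼 → ℝ} {gu gv : 𝔼 → 𝔼}
    (hum : Measurable u) (hvm : Measurable v)
    (hu : IsSobolevLimit u gu) (hv : IsSobolevLimit v gv) :
    Integrable (fun h => ‖h‖ ^ (-((d : ℝ) - 1 + 2 * s)) * sliceForm d s Ω u v h) ∧
    ∫ p in interactionSet Ω, formIntegrand s u u v p =
      ∫ h, ‖h‖ ^ (-((d : ℝ) - 1 + 2 * s)) * sliceForm d s Ω u v h := by
  have hwm : Measurable fun p : 𝔼 × 𝔼 => interactionWeight Ω (p.1 + p.2) p.2 :=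
    (measurable_interactionWeight hΩ).comp
      ((measurable_fst.add measurable_snd).prodMk measurable_snd)
  have hint : Integrable (fun p : 𝔼 × 𝔼 => interactionWeight Ω (p.1 + p.2) p.2 *
      formIntegrand s u u v (p.1 + p.2, p.2)) (volume.prod volume) :=
    (integrable_formIntegrand_add_left hd hs0 hs hum hvm hu hv).bdd_mul
      hwm.aestronglyMeasurable (Eventually.of_forall fun p => abs_interactionWeight_le _ _ _)
  have hslice : ∀ h : 𝔼, ∫ x, interactionWeight Ω (h + x) x *
      formIntegrand s u u v (h + x, x) =
      ‖h‖ ^ (-((d : ℝ) - 1 + 2 * s)) * sliceForm d s Ω u v h := fun h => by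
    rw [sliceForm, ← integral_const_mul]
    congr 1 with x
    rw [formIntegrand_add_left]
    ring
  refine ⟨hint.integral_prod_left.congr (Eventually.of_forall hslice), ?_⟩
  rw [setIntegral_interactionSet_eq hΩ (integrable_formIntegrand hd hs0 hs hum hvm hu hv)
    (formIntegrand_swap s u v)]
  simp_rw [← hslice]
  have hmp := measurePreserving_add_prod (volume : Measure 𝔼) (volume : Measure 𝔼)
  rw [Measure.volume_eq_prod, ← hmp.map_eq, integral_map hmp.measurable.aemeasurable
    (f := fun p => interactionWeight Ω p.1 p.2 * formIntegrand s u u v p) ((measurable_interactionWeight hΩ).mul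
      (measurable_formIntegrand s hum hvm)).aestronglyMeasurable]
  exact integral_prod _ hint

theorem integrable_sphere_prod {Ω : Set 𝔼} {gu gv : 𝔼 → 𝔼}
    (hu : MemLp gu 2 volume) (hv : MemLp gv 2 volume) :
    Integrable (Function.uncurry fun (θ : Metric.sphere (0 : 𝔼) 1) x =>
      GTilde d (1 / 2) (inner ℝ (gu x) (θ : 𝔼)) * inner ℝ (gu x) (θ : 𝔼) * inner ℝ (gv x) (θ : 𝔼))
      ((volume : Measure 𝔼).toSphere.prod (volume.restrict Ω)) := by
  have hb : Integrable (fun x => ‖gu x‖ * ‖gv x‖) := hu.norm.integrable_mul hv.norm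
  have hb' : Integrable (fun p : Metric.sphere (0 : 𝔼) 1 × 𝔼 => ‖gu p.2‖ * ‖gv p.2‖)
      ((volume : Measure 𝔼).toSphere.prod (volume.restrict Ω)) :=
    hb.restrict.comp_snd _
  have hθ : Continuous fun p : Metric.sphere (0 : 𝔼) 1 × 𝔼 => (p.1 : 𝔼) := by fun_prop
  have mu : AEStronglyMeasurable (fun p : Metric.sphere (0 : 𝔼) 1 × 𝔼 => inner ℝ (gu p.2) (p.1 : 𝔼))
      ((volume : Measure 𝔼).toSphere.prod (volume.restrict Ω)) :=
    (hu.1.restrict.comp_snd).inner hθ.aestronglyMeasurable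
  have mv : AEStronglyMeasurable (fun p : Metric.sphere (0 : 𝔼) 1 × 𝔼 => inner ℝ (gv p.2) (p.1 : 𝔼))
      ((volume : Measure 𝔼).toSphere.prod (volume.restrict Ω)) :=
    (hv.1.restrict.comp_snd).inner hθ.aestronglyMeasurable
  refine hb'.mono' ((((continuous_GTilde_right d _).comp_aestronglyMeasurable mu).mul mu).mul mv)
    (Eventually.of_forall fun p => ?_)
  have hp : ‖(p.1 : 𝔼)‖ = 1 := norm_eq_of_mem_sphere p.1
  simp only [Function.uncurry_def]
  rw [norm_mul, norm_mul]
  gcongr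
  · refine (mul_le_of_le_one_left (norm_nonneg _) (abs_GTilde_le_one d (by norm_num) _)).trans ?_
    exact (norm_inner_le_norm _ _).trans (by rw [hp, mul_one])
  · exact (norm_inner_le_norm _ _).trans (by rw [hp, mul_one])

theorem tendsto_rescaledForm_of_measurable (hd : 1 ≤ d) {Ω : Set 𝔼} (hΩ : IsOpen Ω)
    {u v : 𝔼 → ℝ} {gu gv : 𝔼 → 𝔼} (hum : Measurable u) (hvm : Measurable v)
    (hu : IsSobolevLimit u gu) (hv : IsSobolevLimit v gv) :
    Tendsto (fun s : ℝ => rescaledForm s Ω u u v) (𝓝[<] (1 / 2))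
      (𝓝 (∫ x in Ω, inner ℝ (gu x) (gv x) / √(1 + ‖gu x‖ ^ 2))) := by
  have : Nontrivial 𝔼 := Module.nontrivial_of_finrank_pos (R := ℝ) (by simpa using Nat.pos_of_ne_zero (by omega))
  have hev : ∀ᶠ s : ℝ in 𝓝[<] (1 / 2), 0 < s ∧ s < 1 / 2 := by
    filter_upwards [Ioo_mem_nhdsLT (show (0 : ℝ) < 1 / 2 by norm_num)] with s hs using hs
  obtain ⟨A, B, hA, hB, hAB⟩ := hu.exists_eLpNorm_diffQuot_mul_le hv
  have hbound : ∀ s : ℝ, 0 < s → ∀ h : 𝔼, |sliceForm d s Ω u v h| ≤ min A (B / ‖h‖ ^ 2) :=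
    fun s hs h => by
      have := (enorm_sliceForm_le d hs.le Ω hu.1.1 hv.1.1 h).trans (hAB h)
      rw [← ofReal_norm, ENNReal.ofReal_le_ofReal_iff (by positivity)] at this
      exact this
  have hθ : ∀ θ : Metric.sphere (0 : 𝔼) 1, ‖(θ : 𝔼)‖ = 1 := fun θ => norm_eq_of_mem_sphere θ
  have hbA : ∀ θ : Metric.sphere (0 : 𝔼) 1, ∀ s, 0 < s → s < 1 / 2 → ∀ r : ℝ, 0 < r →
      |sliceForm d s Ω u v (r • (θ : 𝔼))| ≤ A := fun θ s hs _ r _ =>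
    (hbound s hs _).trans (min_le_left _ _)
  have hbB : ∀ θ : Metric.sphere (0 : 𝔼) 1, ∀ s, 0 < s → s < 1 / 2 → ∀ r : ℝ, 0 < r →
      |sliceForm d s Ω u v (r • (θ : 𝔼))| ≤ B / r ^ 2 := fun θ s hs _ r hr => by
    have := (hbound s hs (r • (θ : 𝔼))).trans (min_le_right _ _)
    rwa [norm_smul, hθ, mul_one, Real.norm_of_nonneg hr.le] at this
  set α := volume.real (Metric.ball (0 : 𝔼) 1) with hα
  have hα0 : 0 < α := ENNReal.toReal_pos (Metric.measure_ball_pos _ _ one_pos).ne'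
    measure_ball_lt_top.ne
  -- The Jacobian `r ^ (d - 1)` cancels against the kernel, leaving `r ^ (-(2 * s))`.
  have hradial : ∀ (s : ℝ) (θ : Metric.sphere (0 : 𝔼) 1),
      ∫ r in Set.Ioi (0 : ℝ), r ^ (Module.finrank ℝ 𝔼 - 1) *
        (‖r • (θ : 𝔼)‖ ^ (-((d : ℝ) - 1 + 2 * s)) * sliceForm d s Ω u v (r • (θ : 𝔼))) =
      ∫ r in Set.Ioi (0 : ℝ), r ^ (-(2 * s)) * sliceForm d s Ω u v (r • (θ : 𝔼)) := fun s θ => by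
    refine setIntegral_congr_fun measurableSet_Ioi fun r hr => ?_
    have hr : 0 < r := hr
    rw [norm_smul, hθ, mul_one, Real.norm_of_nonneg hr.le, ← mul_assoc, ← Real.rpow_natCast,
      ← Real.rpow_add hr, finrank_euclideanSpace_fin, Nat.cast_sub hd]
    congr 2
    push_cast
    ring
  have hform : ∀ s : ℝ, 0 < s → s < 1 / 2 → rescaledForm s Ω u u v =
      α⁻¹ * ∫ θ : Metric.sphere (0 : 𝔼) 1, (1 - 2 * s) * (∫ r in Set.Ioi (0 : ℝ),
        r ^ (-(2 * s)) * sliceForm d s Ω u v (r • (θ : 𝔼))) ∂(volume : Measure 𝔼).toSphere :=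
    fun s hs0 hs => by
      obtain ⟨h1, h2⟩ := integrable_and_setIntegral_formIntegrand hd hs0 hs hΩ hum hvm hu hv
      rw [rescaledForm, scalingConst, h2, integral_polar _ h1, integral_const_mul]
      simp_rw [hradial]
      ring
  have hmeas : ∀ s : ℝ, 0 < s → s < 1 / 2 →
      AEStronglyMeasurable (fun θ : Metric.sphere (0 : 𝔼) 1 => (1 - 2 * s) *
        ∫ r in Set.Ioi (0 : ℝ), r ^ (-(2 * s)) * sliceForm d s Ω u v (r • (θ : 𝔼)))
        (volume : Measure 𝔼).toSphere := fun s hs0 hs => by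
    obtain ⟨h1, -⟩ := integrable_and_setIntegral_formIntegrand hd hs0 hs hΩ hum hvm hu hv
    have h3 := (integrable_polar _ h1).1
    simp_rw [hradial] at h3
    exact h3.const_mul _
  have hlim : Tendsto (fun s : ℝ => ∫ θ : Metric.sphere (0 : 𝔼) 1, (1 - 2 * s) *
      (∫ r in Set.Ioi (0 : ℝ), r ^ (-(2 * s)) * sliceForm d s Ω u v (r • (θ : 𝔼)))
        ∂(volume : Measure 𝔼).toSphere) (𝓝[<] (1 / 2))
      (𝓝 (∫ θ : Metric.sphere (0 : 𝔼) 1, (∫ x in Ω, GTilde d (1 / 2) (inner ℝ (gu x) (θ : 𝔼)) *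
        inner ℝ (gu x) (θ : 𝔼) * inner ℝ (gv x) (θ : 𝔼)) ∂(volume : Measure 𝔼).toSphere)) := by
    -- The radial bound is a constant independent of `s` and `θ`, hence integrable over the sphere.
    refine tendsto_integral_filter_of_dominated_convergence
      (fun _ => ∫ t in Set.Ioi (0 : ℝ), 2 * (A + B) * (1 + t ^ 2)⁻¹) ?_ ?_
      (integrable_const _) ?_
    · filter_upwards [hev] with s hs using hmeas s hs.1 hs.2
    · filter_upwards [hev] with s hs
      exact Eventually.of_forall fun θ =>
        abs_mul_integral_rpow_mul_le hs.1 hs.2 (hbA θ s hs.1 hs.2) (hbB θ s hs.1 hs.2)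
    · refine Eventually.of_forall fun θ => ?_
      exact tendsto_mul_integral_rpow_mul
        (fun s => (measurable_sliceForm d s hΩ hum hvm).comp (by fun_prop))
        (hbA θ) (hbB θ) (tendsto_sliceForm d hΩ hu hv (hθ θ))
  have hval : ∫ x in Ω, inner ℝ (gu x) (gv x) / √(1 + ‖gu x‖ ^ 2) =
      α⁻¹ * ∫ θ : Metric.sphere (0 : 𝔼) 1, (∫ x in Ω, GTilde d (1 / 2) (inner ℝ (gu x) (θ : 𝔼)) *
        inner ℝ (gu x) (θ : 𝔼) * inner ℝ (gv x) (θ : 𝔼)) ∂(volume : Measure 𝔼).toSphere := by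
    rw [integral_integral_swap (integrable_sphere_prod hu.2.1 hv.2.1)]
    have := fun x => integral_sphere_GTilde (gu x) (gv x)
    rw [finrank_euclideanSpace_fin] at this
    simp_rw [this]
    rw [integral_const_mul, ← hα, inv_mul_cancel_left₀ hα0.ne']
  rw [hval]
  refine (hlim.const_mul α⁻¹).congr' ?_
  filter_upwards [hev] with s hs
  rw [hform s hs.1 hs.2]

/-! ### Independence of representatives and of the choice of weak gradient -/

theorem formIntegrand_congr_ae (s : ℝ) {u u' v v' : 𝔼 → ℝ} (hu : u =ᵐ[volume] u')
    (hv : v =ᵐ[volume] v') : formIntegrand s u u v =ᵐ[volume] formIntegrand s u' u' v' := by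
  have h1 := (Measure.quasiMeasurePreserving_fst (μ := (volume : Measure 𝔼))
    (ν := (volume : Measure 𝔼))).ae (hu.and hv)
  have h2 := (Measure.quasiMeasurePreserving_snd (μ := (volume : Measure 𝔼))
    (ν := (volume : Measure 𝔼))).ae (hu.and hv)
  filter_upwards [h1, h2] with p hp hq
  simp only [formIntegrand, hp.1, hp.2, hq.1, hq.2]

/-- Test functions supported in `Ω` are admissible for both gradients, so the difference integrates
to zero against each of them, and the fundamental lemma of the calculus of variations applies. -/
theorem HasWeakGradient.ae_eq_of_univ {Ω : Set 𝔼} (hΩ : IsOpen Ω) {u : 𝔼 → ℝ} {g g' : 𝔼 → 𝔼}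
    (h : HasWeakGradient Ω u g) (h' : HasWeakGradient Set.univ u g') :
    ∀ᵐ x, x ∈ Ω → g' x = g x := by
  have hloc : LocallyIntegrableOn g' Ω volume := h'.2.1.mono_set (Set.subset_univ Ω)
  have := hΩ.ae_eq_zero_of_integral_contDiff_smul_eq_zero (μ := volume)
    (f := fun x => g' x - g x) (hloc.sub h.2.1) fun φ hφ hφc hφΩ => ?_
  · filter_upwards [this] with x hx hxΩ using sub_eq_zero.1 (hx hxΩ)
  have hφ0 : ∀ x, x ∉ Ω → φ x = 0 := fun x hx =>
    image_eq_zero_of_notMem_tsupport fun hx' => hx (hφΩ hx')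
  have hint : ∀ {f : 𝔼 → 𝔼}, LocallyIntegrableOn f Ω volume → Integrable fun x => φ x • f x :=
    fun {f} hf => by
      rw [← integrableOn_iff_integrable_of_support_subset (s := tsupport φ)]
      · exact (hf.integrableOn_compact_subset hφΩ hφc.isCompact).continuousOn_smul
          hφ.continuous.continuousOn hφc.isCompact
      · intro x hx
        refine subset_tsupport φ fun h0 => hx ?_
        simp [h0]
  have e1 := h.2.2 φ hφ hφc hφΩ
  have e2 := h'.2.2 φ hφ hφc (Set.subset_univ _)
  rw [setIntegral_univ, setIntegral_univ] at e2
  rw [setIntegral_eq_integral_of_forall_compl_eq_zero fun x hx => ?_,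
    setIntegral_eq_integral_of_forall_compl_eq_zero fun x hx => by rw [hφ0 x hx, zero_smul],
    e2, neg_inj] at e1
  · simp_rw [smul_sub]
    rw [integral_sub (hint hloc) (hint h.2.1), e1, sub_self]
  · have h0 : fderiv ℝ φ x = 0 :=
      image_eq_zero_of_notMem_tsupport fun hx' => hx (hφΩ (tsupport_fderiv_subset ℝ hx'))
    rw [show gradient φ x = (InnerProductSpace.toDual ℝ 𝔼).symm (fderiv ℝ φ x) from rfl, h0,
      map_zero, smul_zero]

theorem MemH10.exists_isSobolevLimit {Λ : Set 𝔼} {u : 𝔼 → ℝ} (hu : MemH10 Λ u) :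
    ∃ g : 𝔼 → 𝔼, IsSobolevLimit u g ∧ HasWeakGradient Set.univ u g := by
  obtain ⟨hu2, g, hg2, hg, φ, hφ, h1, h2⟩ := hu
  exact ⟨g, ⟨hu2, hg2, φ, fun n => ⟨(hφ n).1, (hφ n).2.1⟩, h1, h2⟩, hg⟩

theorem integrable_inner_div_sqrt {gu gv : 𝔼 → 𝔼} (hu : MemLp gu 2 volume)
    (hv : MemLp gv 2 volume) :
    Integrable (fun x => inner ℝ (gu x) (gv x) / √(1 + ‖gu x‖ ^ 2)) := by
  have hb : Integrable (fun x => ‖gu x‖ * ‖gv x‖) := hu.norm.integrable_mul hv.norm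
  have hc : Continuous fun a : 𝔼 => (√(1 + ‖a‖ ^ 2))⁻¹ :=
    Continuous.inv₀ (by fun_prop) fun a => by positivity
  simp only [div_eq_mul_inv]
  refine hb.mono' ((hu.1.inner hv.1).mul (hc.comp_aestronglyMeasurable hu.1))
    (Eventually.of_forall fun x => ?_)
  rw [norm_mul]
  refine (mul_le_of_le_one_right (norm_nonneg _) ?_).trans (norm_inner_le_norm _ _)
  rw [Real.norm_of_nonneg (by positivity)]
  exact inv_le_one_of_one_le₀ (Real.one_le_sqrt.2 (le_add_of_nonneg_right (by positivity)))

end Limit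

theorem mainTheorem10 {d : ℕ} (hd : 1 ≤ d)
    (Ω Λ : Set (EuclideanSpace ℝ (Fin d)))
    (hΩ : IsOpen Ω) (hΛ : Bornology.IsBounded Λ) (hΩΛ : Ω ⊆ Λ)
    (u v : EuclideanSpace ℝ (Fin d) → ℝ) (hu : MemH10 Λ u) (hv : MemH10 Λ v)
    (gu gv : EuclideanSpace ℝ (Fin d) → EuclideanSpace ℝ (Fin d))
    (hgu : HasWeakGradient Ω u gu) (hgv : HasWeakGradient Ω v gv) :
    (∀ s : ℝ, 0 < s → s < 1 / 2 →
      IntegrableOn (formIntegrand s u u v) (interactionSet Ω) volume) ∧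
    IntegrableOn (fun x => inner ℝ (gu x) (gv x) / Real.sqrt (1 + ‖gu x‖ ^ 2)) Ω volume ∧
    Tendsto (fun s : ℝ => rescaledForm s Ω u u v) (𝓝[<] (1 / 2))
      (𝓝 (∫ x in Ω, inner ℝ (gu x) (gv x) / Real.sqrt (1 + ‖gu x‖ ^ 2))) := by
  obtain ⟨Gu, hGu, hGu'⟩ := hu.exists_isSobolevLimit
  obtain ⟨Gv, hGv, hGv'⟩ := hv.exists_isSobolevLimit
  have hum : AEMeasurable u := hGu.1.1.aemeasurable
  have hvm : AEMeasurable v := hGv.1.1.aemeasurable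
  -- Borel representatives of `u` and `v` are used from here on; neither the form nor its
  -- integrability sees the change.
  have hGu₁ := hGu.congr hum.ae_eq_mk (EventuallyEq.refl _ Gu)
  have hGv₁ := hGv.congr hvm.ae_eq_mk (EventuallyEq.refl _ Gv)
  have hcongr := fun s => formIntegrand_congr_ae s hum.ae_eq_mk hvm.ae_eq_mk
  have hgrad : (fun x => inner ℝ (Gu x) (Gv x) / √(1 + ‖Gu x‖ ^ 2)) =ᵐ[volume.restrict Ω]
      fun x => inner ℝ (gu x) (gv x) / √(1 + ‖gu x‖ ^ 2) := by
    rw [EventuallyEq, ae_restrict_iff' hΩ.measurableSet]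
    filter_upwards [hgu.ae_eq_of_univ hΩ hGu', hgv.ae_eq_of_univ hΩ hGv'] with x hx hx' hxΩ
    rw [hx hxΩ, hx' hxΩ]
  refine ⟨fun s hs0 hs => ?_, ?_, ?_⟩
  · exact ((integrable_formIntegrand hd hs0 hs hum.measurable_mk hvm.measurable_mk hGu₁ hGv₁).congr
      (hcongr s).symm).integrableOn
  · exact (integrable_inner_div_sqrt hGu.2.1 hGv.2.1).integrableOn.congr hgrad
  · rw [← integral_congr_ae hgrad]
    refine (tendsto_rescaledForm_of_measurable hd hΩ hum.measurable_mk hvm.measurable_mk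
      hGu₁ hGv₁).congr fun s => ?_
    rw [rescaledForm, rescaledForm, integral_congr_ae (ae_restrict_of_ae (hcongr s))]
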